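/- Let $\mathbb{K}$ be a field of characteristic zero. Let $\mathcal{P}=\mathcal{F}(E)/(R)$ be a binary quadratic operad over $\mathbb{K}$: $\mathcal{F}(E)$ is the free symmetric operad on an $S_2$-module $E$ of binary operations, homogeneous of degree $0$ (or, more generally, of an even degree $e$), and $(R)$ is the operadic ideal generated by an $S_3$-stable subspace $R\subset\mathcal{F}(E)(3)$. Let $(A,d)$ be a differential graded $\mathcal{P}$-algebra, where $|d|=+1$ (or, more generally, $|d|=q$ is odd): $A$ is a $\mathbb{Z}$-graded vector space with a representation $\mathcal{P}\to\mathrm{End}(A)$, $d^2=0$, and $d$ is a graded derivation of all operations of the algebra. The Koszul sign convention is used throughout. Let $sA$ be the shifted space, $|sx|=|x|+1$. For every $\mu\in E$, with associated multiplication $[\cdot,\cdot]$ on $A$, define the derived brackets on $sA$, for homogeneous $x$ and arbitrary $y$ in $A$, by $$[sx,sy]_d:=-(-1)^{|x|}s[dx,y],\qquad [sx,sy]^d:=s[x,dy].$$ Let $\mathrm{Perm}$ be the binary quadratic operad of permutation algebras, generated by a multiplication $x_1*x_2$ without symmetry, with the relations $(x_1*x_2)*x_3=x_1*(x_2*x_3)$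 and $(x_1*x_2)*x_3=(x_2*x_1)*x_3$. Let $e^2_2=x_1*x_2$ and $e^2_1=x_2*x_1$ be the basis of its space of generators $E_{\mathrm{Perm}}$, and let $R_{\mathrm{Perm}}$ be its $S_3$-module of relations. Let $$\mathrm{Perm}\circ\mathcal{P}:=\mathcal{F}(E_{\mathrm{Perm}}\otimes E)\big/\big(\Phi^{-1}(R_{\mathrm{Perm}}\otimes\mathcal{F}(E)(3)+\mathcal{F}(E_{\mathrm{Perm}})(3)\otimes R)\big)$$ be the Manin white product, where $\Phi:\mathcal{F}(E_{\mathrm{Perm}}\otimes E)\to\mathcal{F}(E_{\mathrm{Perm}})\otimes\mathcal{F}(E)$ is the operad morphism extending the inclusion of $E_{\mathrm{Perm}}\otimes E$. Then $sA$ with the derived brackets is a $\mathrm{Perm}\circ\mathcal{P}$-algebra: there is an operad morphism $\mathrm{Perm}\circ\mathcal{P}\to\mathrm{End}(sA)$ that sends, for every $\mu\in E$, the generator $e^2_2\otimes\mu$ to $[\cdot,\cdot]_d$ and the generator $e^2_1\otimes\mu$ to $[\cdot,\cdot]^d$. (The generators of $\mathrm{Perm}\circ\mathcal{P}$ are placed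 in degree $e+q-1$, which is $0$ in the case $e=0$, $q=1$.) -/

import Mathlib

open scoped TensorProduct

noncomputable section

universe u v w v₁ v₂

namespace DerivedBrackets

/-! ### Symmetric operads -/

section Positions

variable {m n k : ℕ}

/-- When an operation of arity `n` is inserted into the input `i` of an operation of arity `m`,
the input `a ≠ i` of the outer operation becomes this input of the composite. -/
def outerPos (h : k + 1 = m + n) (i a : Fin m) (ha : a ≠ i) : Fin k :=
  if hlt : a < i then ⟨a, by have := a.2; have := i.2; rw [Fin.lt_def] at hlt; omega⟩
  else ⟨a + n - 1, by
    have := a.2; have := i.2; rw [Fin.lt_def] at hlt; have := Fin.val_ne_of_ne ha; omega⟩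

/-- When an operation of arity `n` is inserted into the input `i` of an operation of arity `m`,
the input `b` of the inner operation becomes this input of the composite. -/
def innerPos (h : k + 1 = m + n) (i : Fin m) (b : Fin n) : Fin k :=
  ⟨i + b, by have := i.2; have := b.2; omega⟩

end Positions

/-- The data underlying a symmetric operad over `K`: for each `n` a vector space of operations
of arity `n` with a (right) action of the symmetric group, a unit, and partial compositions
`f ∘ᵢ g`. The arity `k` of a composite is tied to `m + n - 1` by the equation `k + 1 = m + n`. -/
structure PreOperad (K : Type u) [Field K] where
  /-- the operations of arity `n` -/
  obj : ℕ → Type v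
  [grp : ∀ n, AddCommGroup (obj n)]
  [mod : ∀ n, Module K (obj n)]
  /-- the unit -/
  one : obj 1
  /-- the right action of the symmetric group: `act σ f` is `f σ` -/
  act : ∀ {n : ℕ}, Equiv.Perm (Fin n) → obj n →ₗ[K] obj n
  /-- partial composition: `comp h i f g` is `f ∘ᵢ g` (inputs are counted from `0`) -/
  comp : ∀ {m n k : ℕ} (_ : k + 1 = m + n) (_ : Fin m), obj m →ₗ[K] obj n →ₗ[K] obj k

attribute [instance] PreOperad.grp PreOperad.mod

/-- A symmetric operad over `K` (no signs occur in the associativity laws: all operads below are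
concentrated in even degrees). The permutation `σ ∘ᵢ τ` occurring in the equivariance law is
the permutation `r` described by its values on the outer and on the inner inputs. -/
structure Operad (K : Type u) [Field K] extends PreOperad.{u, v} K where
  act_one : ∀ {n : ℕ} (f : obj n), act 1 f = f
  act_mul : ∀ {n : ℕ} (σ τ : Equiv.Perm (Fin n)) (f : obj n), act (σ * τ) f = act τ (act σ f)
  comp_one : ∀ {m : ℕ} (i : Fin m) (f : obj m), comp rfl i f one = f
  one_comp : ∀ {n : ℕ} (g : obj n), comp (Nat.add_comm n 1) 0 one g = g
  comp_nested : ∀ {m n l k₁ k₂ k : ℕ} (h₁ : k₁ + 1 = m + n) (h : k + 1 = k₁ + l)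
    (h₂ : k₂ + 1 = n + l) (h' : k + 1 = m + k₂) (i : Fin m) (j : Fin n)
    (f : obj m) (g : obj n) (p : obj l),
    comp h (innerPos h₁ i j) (comp h₁ i f g) p = comp h' i f (comp h₂ j g p)
  comp_parallel : ∀ {m n l k₁ k₂ k : ℕ} (h₁ : k₁ + 1 = m + n) (h : k + 1 = k₁ + l)
    (h₂ : k₂ + 1 = m + l) (h' : k + 1 = k₂ + n) (i j : Fin m) (hij : j ≠ i)
    (f : obj m) (g : obj n) (p : obj l),
    comp h (outerPos h₁ i j hij) (comp h₁ i f g) p =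
      comp h' (outerPos h₂ j i hij.symm) (comp h₂ j f p) g
  comp_act : ∀ {m n k : ℕ} (h : k + 1 = m + n) (i : Fin m)
    (σ : Equiv.Perm (Fin m)) (τ : Equiv.Perm (Fin n)) (r : Equiv.Perm (Fin k)),
    (∀ (a : Fin m) (ha : a ≠ i), r (outerPos h i a ha) =
      outerPos h (σ i) (σ a) (σ.injective.ne ha)) →
    (∀ b : Fin n, r (innerPos h i b) = innerPos h (σ i) (τ b)) →
    ∀ (f : obj m) (g : obj n), comp h i (act σ f) (act τ g) = act r (comp h (σ i) f g)

/-- A morphism of operads: equivariant linear maps preserving the unit and the compositions. -/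
structure Hom {K : Type u} [Field K] (P : PreOperad.{u, v} K) (Q : PreOperad.{u, w} K) where
  /-- the component in arity `n` -/
  app : ∀ n : ℕ, P.obj n →ₗ[K] Q.obj n
  map_one : app 1 P.one = Q.one
  map_act : ∀ {n : ℕ} (σ : Equiv.Perm (Fin n)) (f : P.obj n),
    app n (P.act σ f) = Q.act σ (app n f)
  map_comp : ∀ {m n k : ℕ} (h : k + 1 = m + n) (i : Fin m) (f : P.obj m) (g : P.obj n),
    app k (P.comp h i f g) = Q.comp h i (app m f) (app n g)

/-! ### Ideals and quotients -/

section Quotient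

variable {K : Type u} [Field K]

/-- Membership in the operadic ideal generated by a family `S` of operations. -/
inductive PreOperad.Ideal (P : PreOperad.{u, v} K) (S : ∀ n : ℕ, P.obj n → Prop) :
    ∀ n : ℕ, P.obj n → Prop
  | of {n : ℕ} (x : P.obj n) : S n x → PreOperad.Ideal P S n x
  | zero {n : ℕ} : PreOperad.Ideal P S n 0
  | add {n : ℕ} (x y : P.obj n) :
      PreOperad.Ideal P S n x → PreOperad.Ideal P S n y → PreOperad.Ideal P S n (x + y)
  | smul {n : ℕ} (c : K) (x : P.obj n) : PreOperad.Ideal P S n x → PreOperad.Ideal P S n (c • x)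
  | act {n : ℕ} (σ : Equiv.Perm (Fin n)) (x : P.obj n) :
      PreOperad.Ideal P S n x → PreOperad.Ideal P S n (P.act σ x)
  | comp_left {m n k : ℕ} (h : k + 1 = m + n) (i : Fin m) (x : P.obj m) (g : P.obj n) :
      PreOperad.Ideal P S m x → PreOperad.Ideal P S k (P.comp h i x g)
  | comp_right {m n k : ℕ} (h : k + 1 = m + n) (i : Fin m) (f : P.obj m) (x : P.obj n) :
      PreOperad.Ideal P S n x → PreOperad.Ideal P S k (P.comp h i f x)

/-- The arity `n` part of the operadic ideal generated by `S`. -/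
def PreOperad.ideal (P : PreOperad.{u, v} K) (S : ∀ n : ℕ, P.obj n → Prop) (n : ℕ) :
    Submodule K (P.obj n) where
  carrier := {x | P.Ideal S n x}
  zero_mem' := .zero
  add_mem' := fun hx hy => .add _ _ hx hy
  smul_mem' := fun c _ hx => .smul c _ hx

/-- The quotient by the operadic ideal generated by `S`. -/
def PreOperad.quotient (P : PreOperad.{u, v} K) (S : ∀ n : ℕ, P.obj n → Prop) :
    PreOperad.{u, v} K where
  obj := fun n => P.obj n ⧸ P.ideal S n
  one := (P.ideal S 1).mkQ P.one
  act := fun {n} σ => (P.ideal S n).mapQ (P.ideal S n) (P.act σ) fun _ hx => .act σ _ hx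
  comp := fun {m n k} h i =>
    (P.ideal S m).liftQ
      (LinearMap.mk₂ K (fun (f : P.obj m) (g : P.obj n ⧸ P.ideal S n) =>
          (P.ideal S n).mapQ (P.ideal S k) (P.comp h i f) (fun _ hx => .comp_right h i f _ hx) g)
        (by
          rintro f f' ⟨g⟩
          change (P.ideal S k).mkQ (P.comp h i (f + f') g) =
            (P.ideal S k).mkQ (P.comp h i f g) + (P.ideal S k).mkQ (P.comp h i f' g)
          rw [LinearMap.map_add, LinearMap.add_apply, LinearMap.map_add])
        (by
          rintro c f ⟨g⟩
          change (P.ideal S k).mkQ (P.comp h i (c • f) g) =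
            c • (P.ideal S k).mkQ (P.comp h i f g)
          rw [LinearMap.map_smul, LinearMap.smul_apply, LinearMap.map_smul])
        (by intro f g g'; simp)
        (by intro c f g; simp))
      (by
        intro x hx
        refine LinearMap.mem_ker.2 (LinearMap.ext ?_)
        rintro ⟨g⟩
        exact (Submodule.Quotient.mk_eq_zero _).2 (PreOperad.Ideal.comp_left h i x g hx))

/-- The projection onto the quotient. -/
def PreOperad.proj (P : PreOperad.{u, v} K) (S : ∀ n : ℕ, P.obj n → Prop) :
    Hom P (P.quotient S) where
  app := fun n => (P.ideal S n).mkQ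
  map_one := rfl
  map_act := fun _ _ => rfl
  map_comp := fun _ _ _ _ => rfl

theorem PreOperad.proj_surjective (P : PreOperad.{u, v} K) (S : ∀ n : ℕ, P.obj n → Prop) (n : ℕ) :
    Function.Surjective ((P.proj S).app n) := Submodule.mkQ_surjective _

theorem PreOperad.proj_eq (P : PreOperad.{u, v} K) (S : ∀ n : ℕ, P.obj n → Prop) {n : ℕ}
    {x y : P.obj n} (h : S n (x - y)) : (P.proj S).app n x = (P.proj S).app n y :=
  (Submodule.Quotient.eq _).2 (PreOperad.Ideal.of _ h)

/-- A morphism that kills `S` factors through the quotient. -/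
def PreOperad.quotientLift {P : PreOperad.{u, v} K} {S : ∀ n : ℕ, P.obj n → Prop}
    {Q : PreOperad.{u, w} K} (φ : Hom P Q) (hφ : ∀ n x, S n x → φ.app n x = 0) :
    Hom (P.quotient S) Q where
  app := fun n => (P.ideal S n).liftQ (φ.app n) (by
    intro x hx
    change P.Ideal S n x at hx
    rw [LinearMap.mem_ker]
    induction hx with
    | of x hx => exact hφ _ _ hx
    | zero => exact LinearMap.map_zero _
    | add x y _ _ hx hy => rw [LinearMap.map_add, hx, hy, add_zero]
    | smul c x _ hx => rw [LinearMap.map_smul, hx, smul_zero]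
    | act σ x _ hx => rw [φ.map_act, hx, LinearMap.map_zero]
    | comp_left h i x g _ hx => rw [φ.map_comp, hx, LinearMap.map_zero, LinearMap.zero_apply]
    | comp_right h i f x _ hx => rw [φ.map_comp, hx, LinearMap.map_zero])
  map_one := φ.map_one
  map_act := by
    intro n σ f
    obtain ⟨f, rfl⟩ := P.proj_surjective S n f
    exact φ.map_act σ f
  map_comp := by
    intro m n k h i f g
    obtain ⟨f, rfl⟩ := P.proj_surjective S m f
    obtain ⟨g, rfl⟩ := P.proj_surjective S n g
    exact φ.map_comp h i f g

/-- The quotient of an operad by the operadic ideal generated by `S`. -/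
def Operad.quotient (P : Operad.{u, v} K) (S : ∀ n : ℕ, P.obj n → Prop) : Operad.{u, v} K where
  toPreOperad := P.toPreOperad.quotient S
  act_one := by
    intro n f
    obtain ⟨f, rfl⟩ := P.proj_surjective S n f
    rw [← Hom.map_act, P.act_one]
  act_mul := by
    intro n σ τ f
    obtain ⟨f, rfl⟩ := P.proj_surjective S n f
    simp only [← Hom.map_act, P.act_mul]
  comp_one := by
    intro m i f
    obtain ⟨f, rfl⟩ := P.proj_surjective S m f
    rw [← (P.proj S).map_one, ← Hom.map_comp, P.comp_one]
  one_comp := by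
    intro n g
    obtain ⟨g, rfl⟩ := P.proj_surjective S n g
    rw [← (P.proj S).map_one, ← Hom.map_comp, P.one_comp]
  comp_nested := by
    intro m n l k₁ k₂ k h₁ h h₂ h' i j f g p
    obtain ⟨f, rfl⟩ := P.proj_surjective S m f
    obtain ⟨g, rfl⟩ := P.proj_surjective S n g
    obtain ⟨p, rfl⟩ := P.proj_surjective S l p
    simp only [← Hom.map_comp, P.comp_nested h₁ h h₂ h']
  comp_parallel := by
    intro m n l k₁ k₂ k h₁ h h₂ h' i j hij f g p
    obtain ⟨f, rfl⟩ := P.proj_surjective S m f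
    obtain ⟨g, rfl⟩ := P.proj_surjective S n g
    obtain ⟨p, rfl⟩ := P.proj_surjective S l p
    simp only [← Hom.map_comp, P.comp_parallel h₁ h h₂ h' i j hij]
  comp_act := by
    intro m n k h i σ τ r h₁ h₂ f g
    obtain ⟨f, rfl⟩ := P.proj_surjective S m f
    obtain ⟨g, rfl⟩ := P.proj_surjective S n g
    simp only [← Hom.map_comp, ← Hom.map_act, P.comp_act h i σ τ r h₁ h₂]

end Quotient

/-! ### The free operad on an `S₂`-module of binary operations -/

/-- Formal composites of binary operations from `E`, the unit and permutations. -/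
inductive Term (E : Type v) : ℕ → Type v
  | gen (e : E) : Term E 2
  | one : Term E 1
  | act {n : ℕ} (σ : Equiv.Perm (Fin n)) (t : Term E n) : Term E n
  | comp {m n k : ℕ} (h : k + 1 = m + n) (i : Fin m) (s : Term E m) (t : Term E n) : Term E k

section Free

variable {K : Type u} [Field K] {E : Type v}

variable (K E) in
/-- Linear combinations of formal composites, before any relation is imposed. -/
def termOperad : PreOperad.{u, max u v} K where
  obj := fun n => Term E n →₀ K
  one := Finsupp.single Term.one 1
  act := fun σ => Finsupp.lmapDomain K K (Term.act σ)
  comp := fun h i => Finsupp.lsum K fun s => LinearMap.toSpanSingleton K _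
    (Finsupp.lmapDomain K K (Term.comp h i s))

/-- A single formal composite. -/
def term {n : ℕ} (t : Term E n) : (termOperad K E).obj n := Finsupp.single t (1 : K)

theorem termOperad_act_term {n : ℕ} (σ : Equiv.Perm (Fin n)) (t : Term E n) :
    (termOperad K E).act σ (term t) = term (.act σ t) :=
  Finsupp.mapDomain_single

theorem termOperad_comp_term {m n k : ℕ} (h : k + 1 = m + n) (i : Fin m) (s : Term E m)
    (t : Term E n) : (termOperad K E).comp h i (term s) (term t) = term (.comp h i s t) := by
  change (Finsupp.lsum K fun s => LinearMap.toSpanSingleton K _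
    (Finsupp.lmapDomain K K (Term.comp h i s))) (Finsupp.single s 1) (Finsupp.single t 1) = _
  rw [Finsupp.lsum_single, LinearMap.toSpanSingleton_apply, one_smul]
  exact Finsupp.mapDomain_single

theorem termOperad_induction {n : ℕ} {p : (termOperad K E).obj n → Prop}
    (f : (termOperad K E).obj n) (h0 : p 0) (hadd : ∀ x y, p x → p y → p (x + y))
    (hsmul : ∀ (c : K) x, p x → p (c • x)) (hterm : ∀ t, p (term t)) : p f := by
  refine Finsupp.induction_linear (motive := p) f h0 hadd fun t c => ?_
  have : (Finsupp.single t c : Term E n →₀ K) = c • Finsupp.single t 1 := by simp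
  rw [this]
  exact hsmul c _ (hterm t)

variable [AddCommGroup E] [Module K E]

/-- The relations of the free operad: the generators depend linearly and equivariantly on the
elements of `E`, and the laws of an operad hold. -/
inductive FreeRel (ρ : Representation K (Equiv.Perm (Fin 2)) E) :
    ∀ n : ℕ, (termOperad K E).obj n → Prop
  | gen_add (e e' : E) : FreeRel ρ 2
      (term (.gen (e + e')) - (term (.gen e) + term (.gen e')))
  | gen_smul (c : K) (e : E) : FreeRel ρ 2
      (term (.gen (c • e)) - c • term (.gen e))
  | gen_act (σ : Equiv.Perm (Fin 2)) (e : E) : FreeRel ρ 2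
      ((termOperad K E).act σ (term (.gen e)) - term (.gen (ρ σ⁻¹ e)))
  | act_one {n : ℕ} (f : (termOperad K E).obj n) : FreeRel ρ n ((termOperad K E).act 1 f - f)
  | act_mul {n : ℕ} (σ τ : Equiv.Perm (Fin n)) (f : (termOperad K E).obj n) :
      FreeRel ρ n ((termOperad K E).act (σ * τ) f -
        (termOperad K E).act τ ((termOperad K E).act σ f))
  | comp_one {m : ℕ} (i : Fin m) (f : (termOperad K E).obj m) :
      FreeRel ρ m ((termOperad K E).comp rfl i f (termOperad K E).one - f)
  | one_comp {n : ℕ} (g : (termOperad K E).obj n) :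
      FreeRel ρ n ((termOperad K E).comp (Nat.add_comm n 1) 0 (termOperad K E).one g - g)
  | comp_nested {m n l k₁ k₂ k : ℕ} (h₁ : k₁ + 1 = m + n) (h : k + 1 = k₁ + l)
      (h₂ : k₂ + 1 = n + l) (h' : k + 1 = m + k₂) (i : Fin m) (j : Fin n)
      (f : (termOperad K E).obj m) (g : (termOperad K E).obj n) (p : (termOperad K E).obj l) :
      FreeRel ρ k
        ((termOperad K E).comp h (innerPos h₁ i j) ((termOperad K E).comp h₁ i f g) p -
          (termOperad K E).comp h' i f ((termOperad K E).comp h₂ j g p))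
  | comp_parallel {m n l k₁ k₂ k : ℕ} (h₁ : k₁ + 1 = m + n) (h : k + 1 = k₁ + l)
      (h₂ : k₂ + 1 = m + l) (h' : k + 1 = k₂ + n) (i j : Fin m) (hij : j ≠ i)
      (f : (termOperad K E).obj m) (g : (termOperad K E).obj n) (p : (termOperad K E).obj l) :
      FreeRel ρ k
        ((termOperad K E).comp h (outerPos h₁ i j hij) ((termOperad K E).comp h₁ i f g) p -
          (termOperad K E).comp h' (outerPos h₂ j i hij.symm) ((termOperad K E).comp h₂ j f p) g)
  | comp_act {m n k : ℕ} (h : k + 1 = m + n) (i : Fin m)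
      (σ : Equiv.Perm (Fin m)) (τ : Equiv.Perm (Fin n)) (r : Equiv.Perm (Fin k))
      (hσ : ∀ (a : Fin m) (ha : a ≠ i), r (outerPos h i a ha) =
        outerPos h (σ i) (σ a) (σ.injective.ne ha))
      (hτ : ∀ b : Fin n, r (innerPos h i b) = innerPos h (σ i) (τ b))
      (f : (termOperad K E).obj m) (g : (termOperad K E).obj n) :
      FreeRel ρ k
        ((termOperad K E).comp h i ((termOperad K E).act σ f) ((termOperad K E).act τ g) -
          (termOperad K E).act r ((termOperad K E).comp h (σ i) f g))

/-- The free operad `F(E)` on the `S₂`-module `E` placed in arity two. -/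
def freeOperad (ρ : Representation K (Equiv.Perm (Fin 2)) E) : Operad.{u, max u v} K where
  toPreOperad := (termOperad K E).quotient (FreeRel ρ)
  act_one := by
    intro n f
    obtain ⟨f, rfl⟩ := (termOperad K E).proj_surjective (FreeRel ρ) n f
    rw [← Hom.map_act]
    exact PreOperad.proj_eq _ _ (.act_one f)
  act_mul := by
    intro n σ τ f
    obtain ⟨f, rfl⟩ := (termOperad K E).proj_surjective (FreeRel ρ) n f
    simp only [← Hom.map_act]
    exact PreOperad.proj_eq _ _ (.act_mul σ τ f)
  comp_one := by
    intro m i f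
    obtain ⟨f, rfl⟩ := (termOperad K E).proj_surjective (FreeRel ρ) m f
    rw [← ((termOperad K E).proj (FreeRel ρ)).map_one, ← Hom.map_comp]
    exact PreOperad.proj_eq _ _ (.comp_one i f)
  one_comp := by
    intro n g
    obtain ⟨g, rfl⟩ := (termOperad K E).proj_surjective (FreeRel ρ) n g
    rw [← ((termOperad K E).proj (FreeRel ρ)).map_one, ← Hom.map_comp]
    exact PreOperad.proj_eq _ _ (.one_comp g)
  comp_nested := by
    intro m n l k₁ k₂ k h₁ h h₂ h' i j f g p
    obtain ⟨f, rfl⟩ := (termOperad K E).proj_surjective (FreeRel ρ) m f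
    obtain ⟨g, rfl⟩ := (termOperad K E).proj_surjective (FreeRel ρ) n g
    obtain ⟨p, rfl⟩ := (termOperad K E).proj_surjective (FreeRel ρ) l p
    simp only [← Hom.map_comp]
    exact PreOperad.proj_eq _ _ (.comp_nested h₁ h h₂ h' i j f g p)
  comp_parallel := by
    intro m n l k₁ k₂ k h₁ h h₂ h' i j hij f g p
    obtain ⟨f, rfl⟩ := (termOperad K E).proj_surjective (FreeRel ρ) m f
    obtain ⟨g, rfl⟩ := (termOperad K E).proj_surjective (FreeRel ρ) n g
    obtain ⟨p, rfl⟩ := (termOperad K E).proj_surjective (FreeRel ρ) l p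
    simp only [← Hom.map_comp]
    exact PreOperad.proj_eq _ _ (.comp_parallel h₁ h h₂ h' i j hij f g p)
  comp_act := by
    intro m n k h i σ τ r hσ hτ f g
    obtain ⟨f, rfl⟩ := (termOperad K E).proj_surjective (FreeRel ρ) m f
    obtain ⟨g, rfl⟩ := (termOperad K E).proj_surjective (FreeRel ρ) n g
    simp only [← Hom.map_comp, ← Hom.map_act]
    exact PreOperad.proj_eq _ _ (.comp_act h i σ τ r hσ hτ f g)

/-- The inclusion of the generators into the free operad. -/
def freeGen (ρ : Representation K (Equiv.Perm (Fin 2)) E) : E →ₗ[K] (freeOperad ρ).obj 2 where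
  toFun := fun e => ((termOperad K E).proj (FreeRel ρ)).app 2 (term (.gen e))
  map_add' := fun e e' => by
    refine (PreOperad.proj_eq _ _ (.gen_add e e')).trans ?_
    exact LinearMap.map_add _ _ _
  map_smul' := fun c e => by
    refine (PreOperad.proj_eq _ _ (.gen_smul c e)).trans ?_
    exact LinearMap.map_smul _ _ _

theorem act_freeGen (ρ : Representation K (Equiv.Perm (Fin 2)) E) (σ : Equiv.Perm (Fin 2))
    (e : E) : (freeOperad ρ).act σ (freeGen ρ e) = freeGen ρ (ρ σ⁻¹ e) :=
  PreOperad.proj_eq _ _ (.gen_act σ e)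

/-- The value of a formal composite in an operad, given the values of the generators. -/
def Term.eval (Q : Operad.{u, w} K) (ι : E →ₗ[K] Q.obj 2) : ∀ {n : ℕ}, Term E n → Q.obj n
  | _, .gen e => ι e
  | _, .one => Q.one
  | _, .act σ t => Q.act σ (t.eval Q ι)
  | _, .comp h i s t => Q.comp h i (s.eval Q ι) (t.eval Q ι)

/-- The linear extension of `Term.eval`. -/
def termEval (Q : Operad.{u, w} K) (ι : E →ₗ[K] Q.obj 2) (n : ℕ) :
    (termOperad K E).obj n →ₗ[K] Q.obj n :=
  Finsupp.lsum K fun t : Term E n => LinearMap.toSpanSingleton K (Q.obj n) (t.eval Q ι)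

theorem termEval_term (Q : Operad.{u, w} K) (ι : E →ₗ[K] Q.obj 2) {n : ℕ} (t : Term E n) :
    termEval Q ι n (term t) = t.eval Q ι := by
  change (Finsupp.lsum K fun t : Term E n => LinearMap.toSpanSingleton K (Q.obj n) (t.eval Q ι))
    (Finsupp.single t 1) = _
  rw [Finsupp.lsum_single, LinearMap.toSpanSingleton_apply, one_smul]

/-- The morphism from formal composites to an operad that extends a map of generators. -/
def termLift (Q : Operad.{u, w} K) (ι : E →ₗ[K] Q.obj 2) :
    Hom (termOperad K E) Q.toPreOperad where
  app := termEval Q ι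
  map_one := termEval_term Q ι .one
  map_act := by
    intro n σ f
    induction f using termOperad_induction with
    | h0 => simp only [LinearMap.map_zero]
    | hadd x y hx hy => simp only [LinearMap.map_add, hx, hy]
    | hsmul c x hx => simp only [LinearMap.map_smul, hx]
    | hterm t => rw [termOperad_act_term, termEval_term, termEval_term, Term.eval]
  map_comp := by
    intro m n k h i f g
    induction f using termOperad_induction with
    | h0 => simp only [LinearMap.map_zero, LinearMap.zero_apply]
    | hadd x y hx hy => simp only [LinearMap.map_add, LinearMap.add_apply, hx, hy]
    | hsmul c x hx => simp only [LinearMap.map_smul, LinearMap.smul_apply, hx]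
    | hterm s =>
    induction g using termOperad_induction with
    | h0 => simp only [LinearMap.map_zero]
    | hadd x y hx hy => simp only [LinearMap.map_add, hx, hy]
    | hsmul c x hx => simp only [LinearMap.map_smul, hx]
    | hterm t =>
      rw [termOperad_comp_term, termEval_term, termEval_term, termEval_term, Term.eval]

theorem termLift_gen (Q : Operad.{u, w} K) (ι : E →ₗ[K] Q.obj 2) (e : E) :
    (termLift Q ι).app 2 (term (.gen e)) = ι e := by
  change termEval Q ι 2 (term (.gen e)) = _
  rw [termEval_term, Term.eval]

/-- The universal property of the free operad: an equivariant linear map from `E` to the binary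
operations of an operad extends to a morphism of operads. -/
def freeLift (ρ : Representation K (Equiv.Perm (Fin 2)) E) (Q : Operad.{u, w} K)
    (ι : E →ₗ[K] Q.obj 2)
    (hι : ∀ (σ : Equiv.Perm (Fin 2)) (e : E), Q.act σ (ι e) = ι (ρ σ⁻¹ e)) :
    Hom (freeOperad ρ).toPreOperad Q.toPreOperad :=
  PreOperad.quotientLift (termLift Q ι) (by
    intro n x hx
    induction hx with
    | gen_add e e' => 
      rw [LinearMap.map_sub, LinearMap.map_add, termLift_gen, termLift_gen, termLift_gen,
        LinearMap.map_add, sub_self]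
    | gen_smul c e => 
      rw [LinearMap.map_sub, LinearMap.map_smul, termLift_gen, termLift_gen,
        LinearMap.map_smul, sub_self]
    | gen_act σ e => rw [LinearMap.map_sub, Hom.map_act, termLift_gen, termLift_gen, hι, sub_self]
    | act_one f => rw [LinearMap.map_sub, Hom.map_act, Q.act_one, sub_self]
    | act_mul σ τ f => rw [LinearMap.map_sub]; simp only [Hom.map_act]; rw [Q.act_mul, sub_self]
    | comp_one i f => rw [LinearMap.map_sub, Hom.map_comp, Hom.map_one, Q.comp_one, sub_self]
    | one_comp f => rw [LinearMap.map_sub, Hom.map_comp, Hom.map_one, Q.one_comp, sub_self]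
    | comp_nested h₁ h h₂ h' i j f g p =>
      rw [LinearMap.map_sub]; simp only [Hom.map_comp]; rw [Q.comp_nested h₁ h h₂ h', sub_self]
    | comp_parallel h₁ h h₂ h' i j hij f g p =>
      rw [LinearMap.map_sub]; simp only [Hom.map_comp]
      rw [Q.comp_parallel h₁ h h₂ h' i j hij, sub_self]
    | comp_act h i σ τ r hσ hτ f g =>
      rw [LinearMap.map_sub]; simp only [Hom.map_comp, Hom.map_act]
      rw [Q.comp_act h i σ τ r hσ hτ, sub_self])

theorem freeLift_gen (ρ : Representation K (Equiv.Perm (Fin 2)) E) (Q : Operad.{u, w} K)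
    (ι : E →ₗ[K] Q.obj 2)
    (hι : ∀ (σ : Equiv.Perm (Fin 2)) (e : E), Q.act σ (ι e) = ι (ρ σ⁻¹ e)) (e : E) :
    (freeLift ρ Q ι hι).app 2 (freeGen ρ e) = ι e :=
  termLift_gen Q ι e

end Free

/-! ### The tensor product of operads -/

/-- The (arity-wise) tensor product of two operads. -/
def tensorOperad {K : Type u} [Field K] (P : Operad.{u, v₁} K) (Q : Operad.{u, v₂} K) :
    Operad.{u, max v₁ v₂} K where
  obj := fun n => P.obj n ⊗[K] Q.obj n
  one := P.one ⊗ₜ Q.one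
  act := fun σ => TensorProduct.map (P.act σ) (Q.act σ)
  comp := fun h i => TensorProduct.map₂ (P.comp h i) (Q.comp h i)
  act_one := by
    intro n f
    induction f with
    | zero => simp
    | add x y hx hy => rw [map_add, hx, hy]
    | tmul x y => simp [P.act_one, Q.act_one]
  act_mul := by
    intro n σ τ f
    induction f with
    | zero => simp
    | add x y hx hy => simp only [map_add, hx, hy]
    | tmul x y => simp [P.act_mul, Q.act_mul]
  comp_one := by
    intro n i f
    induction f with
    | zero => simp
    | add x y hx hy => simp only [map_add, LinearMap.add_apply, hx, hy]
    | tmul x y => simp [P.comp_one, Q.comp_one]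
  one_comp := by
    intro n f
    induction f with
    | zero => simp
    | add x y hx hy => simp only [map_add, hx, hy]
    | tmul x y => simp [P.one_comp, Q.one_comp]
  comp_nested := by
    intro m n l k₁ k₂ k h₁ h h₂ h' i j f g p
    induction f with
    | zero => simp
    | add x y hx hy => simp only [map_add, LinearMap.add_apply, hx, hy]
    | tmul f f' =>
    induction g with
    | zero => simp
    | add x y hx hy => simp only [map_add, LinearMap.add_apply, hx, hy]
    | tmul g g' =>
    induction p with
    | zero => simp
    | add x y hx hy => simp only [map_add, hx, hy]
    | tmul p p' => simp [P.comp_nested h₁ h h₂ h', Q.comp_nested h₁ h h₂ h']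
  comp_parallel := by
    intro m n l k₁ k₂ k h₁ h h₂ h' i j hij f g p
    induction f with
    | zero => simp
    | add x y hx hy => simp only [map_add, LinearMap.add_apply, hx, hy]
    | tmul f f' =>
    induction g with
    | zero => simp
    | add x y hx hy => simp only [map_add, LinearMap.add_apply, hx, hy]
    | tmul g g' =>
    induction p with
    | zero => simp
    | add x y hx hy => simp only [map_add, LinearMap.add_apply, hx, hy]
    | tmul p p' =>
      simp [P.comp_parallel h₁ h h₂ h' i j hij, Q.comp_parallel h₁ h h₂ h' i j hij]
  comp_act := by
    intro m n k h i σ τ r hσ hτ f g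
    induction f with
    | zero => simp
    | add x y hx hy => simp only [map_add, LinearMap.add_apply, hx, hy]
    | tmul f f' =>
    induction g with
    | zero => simp
    | add x y hx hy => simp only [map_add, hx, hy]
    | tmul g g' => simp [P.comp_act h i σ τ r hσ hτ, Q.comp_act h i σ τ r hσ hτ]

/-! ### Binary quadratic operads and the white product -/

/-- Binary quadratic data `(E, R)`: an `S₂`-module `E` and an `S₃`-stable subspace
`R ⊆ F(E)(3)`. -/
structure QuadraticData (K : Type u) [Field K] where
  /-- the space of generating binary operations -/
  E : Type v
  [grp : AddCommGroup E]
  [mod : Module K E]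
  /-- the action of `S₂` on the generating operations -/
  ρ : Representation K (Equiv.Perm (Fin 2)) E
  /-- the space of quadratic relations -/
  R : Submodule K ((freeOperad ρ).obj 3)
  stable : ∀ (σ : Equiv.Perm (Fin 3)), ∀ x ∈ R, (freeOperad ρ).act σ x ∈ R

attribute [instance] QuadraticData.grp QuadraticData.mod

/-- The elements of `R`, as a family of operations concentrated in arity three. -/
inductive ArityThree {K : Type u} [Field K] {P : PreOperad.{u, v} K} (R : Submodule K (P.obj 3)) :
    ∀ n : ℕ, P.obj n → Prop
  | mk (x : P.obj 3) (hx : x ∈ R) : ArityThree R 3 x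

/-- The binary quadratic operad `P(E, R) = F(E)/(R)`. -/
def QuadraticData.operad {K : Type u} [Field K] (P : QuadraticData.{u, v} K) :
    Operad.{u, max u v} K :=
  (freeOperad P.ρ).quotient (ArityThree P.R)

/-- The operation of arity two of `P(E, R)` given by an element of `E`. -/
def QuadraticData.gen {K : Type u} [Field K] (P : QuadraticData.{u, v} K) :
    P.E →ₗ[K] P.operad.obj 2 :=
  ((freeOperad P.ρ).proj (ArityThree P.R)).app 2 ∘ₗ freeGen P.ρ

/-- The morphism `Φ : F(E₁ ⊗ E₂) → F(E₁) ⊗ F(E₂)` extending the inclusion of `E₁ ⊗ E₂`. -/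
def whitePhi {K : Type u} [Field K] (P : QuadraticData.{u, v₁} K) (Q : QuadraticData.{u, v₂} K) :
    Hom (freeOperad (P.ρ.tprod Q.ρ)).toPreOperad
      (tensorOperad (freeOperad P.ρ) (freeOperad Q.ρ)).toPreOperad :=
  freeLift (P.ρ.tprod Q.ρ) (tensorOperad (freeOperad P.ρ) (freeOperad Q.ρ))
    (TensorProduct.map (freeGen P.ρ) (freeGen Q.ρ)) (by
      intro σ t
      have : TensorProduct.map ((freeOperad P.ρ).act σ) ((freeOperad Q.ρ).act σ) ∘ₗ
          TensorProduct.map (freeGen P.ρ) (freeGen Q.ρ) =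
          TensorProduct.map (freeGen P.ρ) (freeGen Q.ρ) ∘ₗ
            TensorProduct.map (P.ρ σ⁻¹) (Q.ρ σ⁻¹) := by
        rw [← TensorProduct.map_comp, ← TensorProduct.map_comp]
        congr 1
        · exact LinearMap.ext (act_freeGen P.ρ σ)
        · exact LinearMap.ext (act_freeGen Q.ρ σ)
      exact LinearMap.congr_fun this t)

/-- `R₁ ⊗ F(E₂)(3) + F(E₁)(3) ⊗ R₂`, as a subspace of `F(E₁)(3) ⊗ F(E₂)(3)`. -/
def whiteRel {K : Type u} [Field K] (P : QuadraticData.{u, v₁} K) (Q : QuadraticData.{u, v₂} K) :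
    Submodule K ((tensorOperad (freeOperad P.ρ) (freeOperad Q.ρ)).obj 3) :=
  LinearMap.range (TensorProduct.map P.R.subtype
      (LinearMap.id : (freeOperad Q.ρ).obj 3 →ₗ[K] (freeOperad Q.ρ).obj 3)) ⊔
    LinearMap.range (TensorProduct.map
      (LinearMap.id : (freeOperad P.ρ).obj 3 →ₗ[K] (freeOperad P.ρ).obj 3) Q.R.subtype)

theorem whiteRel_stable {K : Type u} [Field K] (P : QuadraticData.{u, v₁} K)
    (Q : QuadraticData.{u, v₂} K) (σ : Equiv.Perm (Fin 3)) :
    whiteRel P Q ≤ (whiteRel P Q).comap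
      ((tensorOperad (freeOperad P.ρ) (freeOperad Q.ρ)).act σ) := by
  refine sup_le ?_ ?_
  · rintro _ ⟨t, rfl⟩
    refine Submodule.mem_sup_left ?_
    refine ⟨TensorProduct.map (((freeOperad P.ρ).act σ).restrict (P.stable σ))
      ((freeOperad Q.ρ).act σ) t, ?_⟩
    refine LinearMap.congr_fun (f := TensorProduct.map P.R.subtype LinearMap.id ∘ₗ
      TensorProduct.map (((freeOperad P.ρ).act σ).restrict (P.stable σ)) ((freeOperad Q.ρ).act σ))
      (g := TensorProduct.map ((freeOperad P.ρ).act σ) ((freeOperad Q.ρ).act σ) ∘ₗ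
        TensorProduct.map P.R.subtype LinearMap.id) ?_ t
    rw [← TensorProduct.map_comp, ← TensorProduct.map_comp]
    rfl
  · rintro _ ⟨t, rfl⟩
    refine Submodule.mem_sup_right ?_
    refine ⟨TensorProduct.map ((freeOperad P.ρ).act σ)
      (((freeOperad Q.ρ).act σ).restrict (Q.stable σ)) t, ?_⟩
    refine LinearMap.congr_fun (f := TensorProduct.map LinearMap.id Q.R.subtype ∘ₗ
      TensorProduct.map ((freeOperad P.ρ).act σ) (((freeOperad Q.ρ).act σ).restrict (Q.stable σ)))
      (g := TensorProduct.map ((freeOperad P.ρ).act σ) ((freeOperad Q.ρ).act σ) ∘ₗ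
        TensorProduct.map LinearMap.id Q.R.subtype) ?_ t
    rw [← TensorProduct.map_comp, ← TensorProduct.map_comp]
    rfl

/-- The Manin white product of binary quadratic data: generators `E₁ ⊗ E₂` and relations
`Φ⁻¹(R₁ ⊗ F(E₂)(3) + F(E₁)(3) ⊗ R₂)`. -/
def whiteProduct {K : Type u} [Field K] (P : QuadraticData.{u, v₁} K)
    (Q : QuadraticData.{u, v₂} K) : QuadraticData.{u, max v₁ v₂} K where
  E := P.E ⊗[K] Q.E
  ρ := P.ρ.tprod Q.ρ
  R := (whiteRel P Q).comap ((whitePhi P Q).app 3)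
  stable := by
    intro σ x hx
    rw [Submodule.mem_comap, Hom.map_act]
    exact whiteRel_stable P Q σ hx

/-! ### The operad of permutation algebras -/

/-- The `S₂`-module `K²`, with the two basis vectors permuted. -/
def permRep (K : Type u) [Field K] : Representation K (Equiv.Perm (Fin 2)) (Fin 2 → K) where
  toFun := fun σ => LinearMap.funLeft K K ⇑σ⁻¹
  map_one' := rfl
  map_mul' := fun _ _ => rfl

/-- `permGen K 1` is the multiplication `x₁ * x₂` of permutation algebras, `permGen K 0` is its
transpose `x₂ * x₁`: the index marks the rightmost factor. -/
def permGen (K : Type u) [Field K] (j : Fin 2) : Fin 2 → K := Pi.single j 1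

/-- The associator `(x₁ * x₂) * x₃ - x₁ * (x₂ * x₃)`. -/
def permAssoc (K : Type u) [Field K] : (freeOperad (permRep K)).obj 3 :=
  (freeOperad (permRep K)).comp (n := 2) rfl (0 : Fin 2)
      (freeGen (permRep K) (permGen K 1)) (freeGen (permRep K) (permGen K 1)) -
    (freeOperad (permRep K)).comp (n := 2) rfl (1 : Fin 2)
      (freeGen (permRep K) (permGen K 1)) (freeGen (permRep K) (permGen K 1))

/-- The element `(x₁ * x₂) * x₃ - (x₂ * x₁) * x₃`. -/
def permComm (K : Type u) [Field K] : (freeOperad (permRep K)).obj 3 :=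
  (freeOperad (permRep K)).comp (n := 2) rfl (0 : Fin 2)
      (freeGen (permRep K) (permGen K 1)) (freeGen (permRep K) (permGen K 1)) -
    (freeOperad (permRep K)).comp (n := 2) rfl (0 : Fin 2)
      (freeGen (permRep K) (permGen K 1)) (freeGen (permRep K) (permGen K 0))

/-- The binary quadratic data of the operad `Perm`: the relations are the `S₃`-submodule generated
by associativity and `(x * y) * z = (y * x) * z`. -/
def permData (K : Type u) [Field K] : QuadraticData.{u, u} K where
  E := Fin 2 → K
  ρ := permRep K
  R := Submodule.span K {x | ∃ σ : Equiv.Perm (Fin 3),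
    x = (freeOperad (permRep K)).act σ (permAssoc K) ∨
      x = (freeOperad (permRep K)).act σ (permComm K)}
  stable := by
    intro τ x hx
    induction hx using Submodule.span_induction with
    | mem x hx =>
      obtain ⟨σ, rfl | rfl⟩ := hx
      · exact Submodule.subset_span ⟨σ * τ, Or.inl (Operad.act_mul _ _ _ _).symm⟩
      · exact Submodule.subset_span ⟨σ * τ, Or.inr (Operad.act_mul _ _ _ _).symm⟩
    | zero => rw [map_zero]; exact Submodule.zero_mem _
    | add x y _ _ hx hy => rw [map_add]; exact Submodule.add_mem _ hx hy
    | smul c x _ hx => rw [map_smul]; exact Submodule.smul_mem _ _ hx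

/-! ### Graded vector spaces and the endomorphism operad -/

/-- A `ℤ`-graded vector space, as the direct sum of its homogeneous subspaces. -/
structure GradedSpace (K : Type u) [Field K] where
  /-- the total space -/
  carrier : Type w
  [grp : AddCommGroup carrier]
  [mod : Module K carrier]
  /-- the subspace of homogeneous elements of a given degree -/
  deg : ℤ → Submodule K carrier
  isInternal : DirectSum.IsInternal deg

attribute [instance] GradedSpace.grp GradedSpace.mod

/-- The sign exponent of the Koszul rule for the permutation `σ` of homogeneous elements of
parities `p`: each inversion of `σ` contributes the product of the two parities. -/
def koszulExp {n : ℕ} (σ : Equiv.Perm (Fin n)) (p : Fin n → ZMod 2) : ZMod 2 :=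
  ∑ i, ∑ j, if i < j ∧ σ j < σ i then p i * p j else 0

/-- The sign `(-1) ^ a`, as a scalar. -/
def parSign (K : Type u) [Field K] (a : ZMod 2) : K := if a = 0 then 1 else -1

section Signs

theorem perm_inv_apply {α : Type*} (σ : Equiv.Perm α) (a : α) : σ⁻¹ (σ a) = a :=
  σ.symm_apply_apply a

theorem zmod_two_cases (a : ZMod 2) : a = 0 ∨ a = 1 := by
  revert a; decide

theorem parSign_add (K : Type u) [Field K] (a b : ZMod 2) :
    parSign K (a + b) = parSign K a * parSign K b := by
  have h : (1 : ZMod 2) + 1 = 0 := by decide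
  rcases zmod_two_cases a with rfl | rfl <;> rcases zmod_two_cases b with rfl | rfl <;>
    simp [parSign, h]

theorem koszulExp_one {n : ℕ} (p : Fin n → ZMod 2) : koszulExp 1 p = 0 := by
  unfold koszulExp
  refine Finset.sum_eq_zero fun i _ => Finset.sum_eq_zero fun j _ => if_neg ?_
  rintro ⟨h, h'⟩
  exact lt_asymm h h'

theorem sum_antisymm {n : ℕ} (X : Fin n → Fin n → ZMod 2) (h : ∀ i j, X i j + X j i = 0)
    (h0 : ∀ i, X i i = 0) : ∑ i, ∑ j, X i j = 0 := by
  rw [← Finset.sum_product']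
  refine Finset.sum_involution (fun a _ => (a.2, a.1)) ?_ ?_ ?_ ?_
  · intro a _; exact h _ _
  · rintro ⟨i, j⟩ _ hne heq
    simp only [Prod.mk.injEq] at heq
    exact hne (by rw [heq.1]; exact h0 _)
  · intro a _; simp
  · intro a _; rfl

theorem koszulExp_mul {n : ℕ} (σ τ : Equiv.Perm (Fin n)) (p : Fin n → ZMod 2) :
    koszulExp (σ * τ) p = koszulExp τ p + koszulExp σ (fun i => p (τ⁻¹ i)) := by
  have h2 : koszulExp σ (fun i => p (τ⁻¹ i)) =
      ∑ i, ∑ j, if τ i < τ j ∧ σ (τ j) < σ (τ i) then p i * p j else 0 := by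
    unfold koszulExp
    rw [← Equiv.sum_comp τ]
    refine Finset.sum_congr rfl fun i _ => ?_
    rw [← Equiv.sum_comp τ]
    simp
  have hch : ∀ a : ZMod 2, a + a = 0 := by decide
  rw [h2, ← sub_eq_zero]
  unfold koszulExp
  rw [← Finset.sum_add_distrib, ← Finset.sum_sub_distrib]
  simp only [← Finset.sum_add_distrib, ← Finset.sum_sub_distrib]
  refine sum_antisymm _ ?_ ?_
  · intro i j
    rcases eq_or_ne i j with rfl | hij
    · simp
    have hτ : τ i ≠ τ j := τ.injective.ne hij
    have hσ : σ (τ i) ≠ σ (τ j) := σ.injective.ne hτ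
    have hc : p j * p i = p i * p j := mul_comm _ _
    rw [hc]
    generalize p i * p j = c
    simp only [Equiv.Perm.mul_apply]
    rcases lt_or_gt_of_ne hij with h | h <;> rcases lt_or_gt_of_ne hτ with h' | h' <;>
      rcases lt_or_gt_of_ne hσ with h'' | h'' <;>
      simp [h, h', h'', h.not_gt, h'.not_gt, h''.not_gt, hch]
  · intro i
    simp

end Signs

section PositionLemmas

variable {m n k : ℕ} (h : k + 1 = m + n) (i : Fin m)

theorem outerPos_val (a : Fin m) (ha : a ≠ i) :
    (outerPos h i a ha : ℕ) = if a < i then (a : ℕ) else a + n - 1 := by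
  unfold outerPos; split_ifs <;> rfl

theorem innerPos_val (b : Fin n) : (innerPos h i b : ℕ) = i + b := rfl

/-- The inputs of a composite are the outer and the inner ones. -/
def posEquiv : {a : Fin m // a ≠ i} ⊕ Fin n ≃ Fin k :=
  Equiv.ofBijective (Sum.elim (fun a => outerPos h i a.1 a.2) (innerPos h i)) (by
    constructor
    · rintro (⟨a, ha⟩ | b) (⟨a', ha'⟩ | b') heq <;>
        simp only [Sum.elim_inl, Sum.elim_inr, Fin.ext_iff, outerPos_val, innerPos_val,
          Fin.lt_def] at heq <;>
        simp only [ne_eq] at * <;>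
        (try have := b.2) <;> (try have := b'.2) <;>
        simp only [Sum.inl.injEq, Sum.inr.injEq, Subtype.mk.injEq, Fin.ext_iff, reduceCtorEq] <;>
        (try split_ifs at heq) <;> omega
    · intro c
      have hc := c.2
      have hi := i.2
      by_cases h1 : (c : ℕ) < i
      · refine ⟨Sum.inl ⟨⟨c, by omega⟩, by simp only [ne_eq, Fin.ext_iff]; omega⟩, ?_⟩
        simp [Fin.ext_iff, outerPos_val, Fin.lt_def, h1]
      by_cases h2 : (c : ℕ) < i + n
      · refine ⟨Sum.inr ⟨c - i, by omega⟩, ?_⟩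
        simp only [Sum.elim_inr, Fin.ext_iff, innerPos_val]; omega
      · refine ⟨Sum.inl ⟨⟨c + 1 - n, by omega⟩, by simp only [ne_eq, Fin.ext_iff]; omega⟩, ?_⟩
        simp only [Sum.elim_inl, Fin.ext_iff, outerPos_val, Fin.lt_def]
        split_ifs <;> omega)

theorem posEquiv_inl (a : {a : Fin m // a ≠ i}) :
    posEquiv h i (Sum.inl a) = outerPos h i a.1 a.2 := rfl

theorem posEquiv_inr (b : Fin n) : posEquiv h i (Sum.inr b) = innerPos h i b := rfl

theorem pos_cases (c : Fin k) :
    (∃ (a : Fin m) (ha : a ≠ i), c = outerPos h i a ha) ∨ ∃ b : Fin n, c = innerPos h i b := by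
  obtain ⟨a | b, rfl⟩ := (posEquiv h i).surjective c
  · exact Or.inl ⟨a.1, a.2, rfl⟩
  · exact Or.inr ⟨b, rfl⟩

theorem outerPos_inj {a a' : Fin m} (ha : a ≠ i) (ha' : a' ≠ i) :
    outerPos h i a ha = outerPos h i a' ha' ↔ a = a' := by
  refine ⟨fun heq => ?_, fun heq => by subst heq; rfl⟩
  have := (posEquiv h i).injective (a₁ := Sum.inl ⟨a, ha⟩) (a₂ := Sum.inl ⟨a', ha'⟩) heq
  simpa using this

theorem innerPos_inj {b b' : Fin n} : innerPos h i b = innerPos h i b' ↔ b = b' := by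
  simp only [Fin.ext_iff, innerPos_val]; omega

theorem outerPos_ne_innerPos {a : Fin m} (ha : a ≠ i) (b : Fin n) :
    outerPos h i a ha ≠ innerPos h i b := by
  intro heq
  have := (posEquiv h i).injective (a₁ := Sum.inl ⟨a, ha⟩) (a₂ := Sum.inr b) heq
  simp at this

theorem outerPos_lt_outerPos {a a' : Fin m} (ha : a ≠ i) (ha' : a' ≠ i) :
    outerPos h i a ha < outerPos h i a' ha' ↔ a < a' := by
  simp only [ne_eq, Fin.ext_iff] at ha ha'
  simp only [Fin.lt_def, outerPos_val]
  split_ifs <;> omega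

theorem outerPos_lt_innerPos {a : Fin m} (ha : a ≠ i) (b : Fin n) :
    outerPos h i a ha < innerPos h i b ↔ a < i := by
  simp only [ne_eq, Fin.ext_iff] at ha
  have := b.2
  simp only [Fin.lt_def, outerPos_val, innerPos_val]
  split_ifs <;> omega

theorem innerPos_lt_outerPos {a : Fin m} (ha : a ≠ i) (b : Fin n) :
    innerPos h i b < outerPos h i a ha ↔ i < a := by
  simp only [ne_eq, Fin.ext_iff] at ha
  have := b.2
  simp only [Fin.lt_def, outerPos_val, innerPos_val]
  split_ifs <;> omega

theorem innerPos_lt_innerPos (b b' : Fin n) :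
    innerPos h i b < innerPos h i b' ↔ b < b' := by
  simp only [Fin.lt_def, innerPos_val]; omega

theorem sum_pos {M : Type*} [AddCommMonoid M] (F : Fin k → M) :
    ∑ c, F c = (∑ a : {a : Fin m // a ≠ i}, F (outerPos h i a.1 a.2)) +
      ∑ b, F (innerPos h i b) := by
  rw [← Equiv.sum_comp (posEquiv h i), Fintype.sum_sum_type]
  rfl

theorem sum_ne {M : Type*} [AddCommMonoid M] (G : Fin m → M) :
    ∑ a, G a = (∑ a : {a : Fin m // a ≠ i}, G a.1) + G i := by
  rw [add_comm, Fintype.sum_eq_add_sum_subtype_ne]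

theorem koszulExp_comp (σ : Equiv.Perm (Fin m)) (τ : Equiv.Perm (Fin n))
    (r : Equiv.Perm (Fin k))
    (hσ : ∀ (a : Fin m) (ha : a ≠ i), r (outerPos h i a ha) =
      outerPos h (σ i) (σ a) (σ.injective.ne ha))
    (hτ : ∀ b : Fin n, r (innerPos h i b) = innerPos h (σ i) (τ b))
    (p : Fin k → ZMod 2) (q : Fin m → ZMod 2)
    (hq : ∀ (a : Fin m) (ha : a ≠ i), q a = p (outerPos h i a ha))
    (hqi : q i = ∑ b, p (innerPos h i b)) :
    koszulExp r p = koszulExp σ q + koszulExp τ (fun b => p (innerPos h i b)) := by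
  unfold koszulExp
  rw [sum_pos h i, sum_ne i]
  simp only [sum_pos h i, sum_ne i (fun a => ite _ _ _), hσ, hτ, outerPos_lt_outerPos,
    outerPos_lt_innerPos, innerPos_lt_outerPos, innerPos_lt_innerPos]
  rw [Finset.sum_add_distrib, Finset.sum_add_distrib, Finset.sum_add_distrib]
  have e1 : ∀ a : {a : Fin m // a ≠ i}, p (outerPos h i a.1 a.2) = q a.1 :=
    fun a => (hq a.1 a.2).symm
  simp only [e1, lt_irrefl, false_and, if_false, add_zero]
  have e2 : ∀ a : {a : Fin m // a ≠ i},
      (∑ b, if a.1 < i ∧ σ i < σ a.1 then q a.1 * p (innerPos h i b) else 0) =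
        if a.1 < i ∧ σ i < σ a.1 then q a.1 * q i else 0 := by
    intro a
    split_ifs
    · rw [hqi, Finset.mul_sum]
    · simp
  have e3 : (∑ b, ∑ a : {a : Fin m // a ≠ i},
      if i < a.1 ∧ σ a.1 < σ i then p (innerPos h i b) * q a.1 else 0) =
      ∑ a : {a : Fin m // a ≠ i}, if i < a.1 ∧ σ a.1 < σ i then q i * q a.1 else 0 := by
    rw [Finset.sum_comm]
    refine Finset.sum_congr rfl fun a _ => ?_
    split_ifs
    · rw [hqi, Finset.sum_mul]
    · simp
  rw [e3, Finset.sum_congr rfl fun a _ => e2 a]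
  ring

end PositionLemmas

section Endomorphisms

variable {K : Type u} [Field K] (V : GradedSpace.{u, w} K)

/-- The multilinear operations of arity `n` on (the total space of) `V`. -/
abbrev MultiMap (n : ℕ) : Type w :=
  MultilinearMap K (fun _ : Fin n => V.carrier) V.carrier

/-- The multilinear operations of arity `n` and degree `d`. -/
def homogeneousMaps (n : ℕ) (d : ℤ) : Submodule K (MultiMap V n) where
  carrier := {f | ∀ (p : Fin n → ℤ) (x : Fin n → V.carrier), (∀ i, x i ∈ V.deg (p i)) →
    f x ∈ V.deg (∑ i, p i + d)}
  zero_mem' := fun _ _ _ => Submodule.zero_mem _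
  add_mem' := fun hf hg p x hx => Submodule.add_mem _ (hf p x hx) (hg p x hx)
  smul_mem' := fun c _ hf p x hx => Submodule.smul_mem _ c (hf p x hx)

/-- The projection onto the even (`a = 0`) or odd (`a = 1`) part of `V`. -/
def parityProj (a : ZMod 2) : V.carrier →ₗ[K] V.carrier :=
  DirectSum.toModule K ℤ V.carrier (fun i => if (i : ZMod 2) = a then (V.deg i).subtype else 0) ∘ₗ
    (LinearEquiv.ofBijective (DirectSum.coeLinearMap V.deg) V.isInternal).symm.toLinearMap

theorem parityProj_of_mem (a : ZMod 2) {i : ℤ} {x : V.carrier} (hx : x ∈ V.deg i) :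
    parityProj V a x = if (i : ZMod 2) = a then x else 0 := by
  have : (LinearEquiv.ofBijective (DirectSum.coeLinearMap V.deg) V.isInternal).symm x =
      DirectSum.lof K ℤ (fun i => V.deg i) i ⟨x, hx⟩ := by
    rw [LinearEquiv.symm_apply_eq]
    exact (DirectSum.coeLinearMap_lof V.deg i ⟨x, hx⟩).symm
  unfold parityProj
  rw [LinearMap.comp_apply, LinearEquiv.coe_coe, this, DirectSum.toModule_lof]
  split_ifs <;> rfl

variable {V} in
/-- A multilinear map is determined by its values on homogeneous elements. -/
theorem multiMap_ext {n : ℕ} {f g : MultiMap V n}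
    (hfg : ∀ (p : Fin n → ℤ) (x : Fin n → V.carrier), (∀ i, x i ∈ V.deg (p i)) → f x = g x) :
    f = g := by
  classical
  ext x
  have hx : ∀ i, ∃ y : DirectSum ℤ fun j => V.deg j, DirectSum.coeLinearMap V.deg y = x i :=
    fun i => V.isInternal.2 (x i)
  choose y hy using hx
  have hx' : x = fun i => ∑ j ∈ DFinsupp.support (y i), (y i j : V.carrier) := by
    funext i
    rw [← hy i, DirectSum.coeLinearMap_eq_dfinsuppSum]
    rfl
  rw [hx', MultilinearMap.map_sum_finset, MultilinearMap.map_sum_finset]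
  exact Finset.sum_congr rfl fun r _ => hfg r _ fun i => (y i (r i)).2

/-- The right action of the symmetric group on multilinear maps with the Koszul sign: on
homogeneous elements, `(f σ)(x₁, …, xₙ) = ± f(x_{σ⁻¹(1)}, …, x_{σ⁻¹(n)})`; see
`endAct_apply`. -/
def endAct {n : ℕ} (σ : Equiv.Perm (Fin n)) (f : MultiMap V n) : MultiMap V n :=
  ∑ p : Fin n → ZMod 2, parSign K (koszulExp σ p) •
    (f.domDomCongr σ⁻¹).compLinearMap fun i => parityProj V (p i)

theorem endAct_apply {n : ℕ} (σ : Equiv.Perm (Fin n)) (f : MultiMap V n) (p : Fin n → ℤ)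
    (x : Fin n → V.carrier) (hx : ∀ i, x i ∈ V.deg (p i)) :
    endAct V σ f x = parSign K (koszulExp σ fun i => (p i : ZMod 2)) • f fun i => x (σ⁻¹ i) := by
  unfold endAct
  rw [sum_apply, Finset.sum_eq_single (fun i => (p i : ZMod 2))]
  · rw [smul_apply, MultilinearMap.compLinearMap_apply,
      MultilinearMap.domDomCongr_apply]
    congr 2
    funext i
    rw [parityProj_of_mem V _ (hx _), if_pos rfl]
  · intro q _ hq
    obtain ⟨i, hi⟩ := Function.ne_iff.1 hq
    rw [smul_apply, MultilinearMap.compLinearMap_apply,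
      MultilinearMap.domDomCongr_apply, MultilinearMap.map_coord_zero _ (σ i), smul_zero]
    rw [perm_inv_apply, parityProj_of_mem V _ (hx _), if_neg hi.symm]
  · intro hn
    exact absurd (Finset.mem_univ _) hn

theorem endAct_mem {n : ℕ} {d : ℤ} (σ : Equiv.Perm (Fin n)) {f : MultiMap V n}
    (hf : f ∈ homogeneousMaps V n d) : endAct V σ f ∈ homogeneousMaps V n d := by
  intro p x hx
  rw [endAct_apply V σ f p x hx]
  have := hf (fun i => p (σ⁻¹ i)) (fun i => x (σ⁻¹ i)) fun i => hx _
  rw [Equiv.sum_comp σ⁻¹ p] at this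
  exact Submodule.smul_mem _ _ this

variable {V} in
/-- The inputs of the outer operation of a composite, where `v` is the output of the inner one. -/
def plug {m n k : ℕ} (h : k + 1 = m + n) (i : Fin m) (x : Fin k → V.carrier) (v : V.carrier) :
    Fin m → V.carrier :=
  fun a => if ha : a = i then v else x (outerPos h i a ha)

theorem plug_self {m n k : ℕ} (h : k + 1 = m + n) (i : Fin m) (x : Fin k → V.carrier)
    (v : V.carrier) : plug h i x v i = v := dif_pos rfl

theorem plug_ne {m n k : ℕ} (h : k + 1 = m + n) (i : Fin m) (x : Fin k → V.carrier)
    (v : V.carrier) {a : Fin m} (ha : a ≠ i) : plug h i x v a = x (outerPos h i a ha) := dif_neg ha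

theorem update_plug {m n k : ℕ} (h : k + 1 = m + n) (i : Fin m) (x : Fin k → V.carrier)
    (v v' : V.carrier) : Function.update (plug h i x v) i v' = plug h i x v' := by
  funext a
  by_cases ha : a = i
  · subst ha; rw [Function.update_self, plug_self]
  · rw [Function.update_of_ne ha, plug_ne V h i x v ha, plug_ne V h i x v' ha]

theorem plug_update_outer {m n k : ℕ} (h : k + 1 = m + n) (i : Fin m) (x : Fin k → V.carrier)
    (v : V.carrier) {a : Fin m} (ha : a ≠ i) (y : V.carrier) :
    plug h i (Function.update x (outerPos h i a ha) y) v = Function.update (plug h i x v) a y := by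
  funext a'
  by_cases ha' : a' = i
  · subst ha'; rw [plug_self, Function.update_of_ne ha.symm, plug_self]
  · rw [plug_ne V h i _ v ha', Function.update_apply, Function.update_apply,
      plug_ne V h i x v ha']
    simp only [outerPos_inj]

theorem plug_update_inner {m n k : ℕ} (h : k + 1 = m + n) (i : Fin m) (x : Fin k → V.carrier)
    (v : V.carrier) (b : Fin n) (y : V.carrier) :
    plug h i (Function.update x (innerPos h i b) y) v = plug h i x v := by
  funext a
  by_cases ha : a = i
  · subst ha; rw [plug_self, plug_self]
  · rw [plug_ne V h i _ v ha, plug_ne V h i _ v ha,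
      Function.update_of_ne (outerPos_ne_innerPos h i ha b)]

theorem inner_update_outer {m n k : ℕ} (h : k + 1 = m + n) (i : Fin m) (x : Fin k → V.carrier)
    {a : Fin m} (ha : a ≠ i) (y : V.carrier) :
    (fun b => Function.update x (outerPos h i a ha) y (innerPos h i b)) =
      fun b => x (innerPos h i b) :=
  funext fun b => Function.update_of_ne (outerPos_ne_innerPos h i ha b).symm _ _

theorem inner_update_inner {m n k : ℕ} (h : k + 1 = m + n) (i : Fin m) (x : Fin k → V.carrier)
    (b : Fin n) (y : V.carrier) :
    (fun b' => Function.update x (innerPos h i b) y (innerPos h i b')) =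
      Function.update (fun b' => x (innerPos h i b')) b y := by
  funext b'
  simp only [Function.update_apply, innerPos_inj]

/-- The partial composition of multilinear maps:
`f(x₁, …, x_{i-1}, g(x_i, …, x_{i+n-1}), x_{i+n}, …, x_{m+n-1})`. -/
def endComp {m n k : ℕ} (h : k + 1 = m + n) (i : Fin m) (f : MultiMap V m) (g : MultiMap V n) :
    MultiMap V k :=
  MultilinearMap.mk' (fun x => f (plug h i x (g fun b => x (innerPos h i b))))
    (by
      intro x c y z
      rcases pos_cases h i c with ⟨a, ha, rfl⟩ | ⟨b, rfl⟩
      · simp only [plug_update_outer, inner_update_outer, MultilinearMap.map_update_add]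
      · simp only [plug_update_inner, inner_update_inner, MultilinearMap.map_update_add]
        rw [← update_plug V h i x 0, MultilinearMap.map_update_add, update_plug, update_plug])
    (by
      intro x c t y
      rcases pos_cases h i c with ⟨a, ha, rfl⟩ | ⟨b, rfl⟩
      · simp only [plug_update_outer, inner_update_outer, MultilinearMap.map_update_smul]
      · simp only [plug_update_inner, inner_update_inner, MultilinearMap.map_update_smul]
        rw [← update_plug V h i x 0, MultilinearMap.map_update_smul, update_plug])

theorem endComp_apply {m n k : ℕ} (h : k + 1 = m + n) (i : Fin m) (f : MultiMap V m)
    (g : MultiMap V n) (x : Fin k → V.carrier) :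
    endComp V h i f g x = f (plug h i x (g fun b => x (innerPos h i b))) := rfl

theorem plug_mem {m n k : ℕ} (h : k + 1 = m + n) (i : Fin m) {p : Fin k → ℤ}
    {x : Fin k → V.carrier} (hx : ∀ c, x c ∈ V.deg (p c)) {v : V.carrier} {d : ℤ}
    (hv : v ∈ V.deg d) (a : Fin m) :
    plug h i x v a ∈ V.deg (if ha : a = i then d else p (outerPos h i a ha)) := by
  by_cases ha : a = i
  · subst ha; rw [plug_self, dif_pos rfl]; exact hv
  · rw [plug_ne V h i x v ha, dif_neg ha]; exact hx _

theorem endComp_mem {m n k : ℕ} (h : k + 1 = m + n) (i : Fin m) {d e : ℤ} {f : MultiMap V m}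
    {g : MultiMap V n} (hf : f ∈ homogeneousMaps V m d) (hg : g ∈ homogeneousMaps V n e) :
    endComp V h i f g ∈ homogeneousMaps V k (d + e) := by
  intro p x hx
  have h1 := hg _ _ fun b => hx (innerPos h i b)
  have h2 := hf _ _ (plug_mem V h i hx h1)
  rw [endComp_apply]
  convert h2 using 2
  rw [sum_pos h i p, sum_ne i (fun a => dite _ _ _), dif_pos rfl]
  have : ∀ a : {a : Fin m // a ≠ i}, (if ha : a.1 = i then ∑ b, p (innerPos h i b) + e
      else p (outerPos h i a.1 ha)) = p (outerPos h i a.1 a.2) := fun a => dif_neg a.2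
  rw [Finset.sum_congr rfl fun a _ => this a]
  ring

/-- The part of the endomorphism operad of `V` in which a representation of an operad generated
by binary operations of degree `e` takes its values: in arity `n`, the multilinear operations of
degree `(n - 1) e`. As `e` is even, the composition involves no Koszul sign. -/
def endOperad (e : ℤ) (he : Even e) : Operad.{u, w} K where
  obj := fun n => homogeneousMaps V n ((n - 1) * e)
  one := ⟨MultilinearMap.ofSubsingleton K V.carrier V.carrier (0 : Fin 1) LinearMap.id, by
    intro p x hx
    simpa using hx 0⟩
  act := fun {n} σ =>
    { toFun := fun f => ⟨endAct V σ f.1, endAct_mem V σ f.2⟩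
      map_add' := fun f g => Subtype.ext (multiMap_ext fun p x hx => by
        simp [endAct_apply V σ _ p x hx])
      map_smul' := fun c f => Subtype.ext (multiMap_ext fun p x hx => by
        simp [endAct_apply V σ _ p x hx, smul_comm c]) }
  comp := fun {m n k} h i => LinearMap.mk₂ K
    (fun f g => ⟨endComp V h i f.1 g.1, by
      have h1 := endComp_mem V h i f.2 g.2
      have h2 : (k : ℤ) + 1 = m + n := by exact_mod_cast h
      have h3 : ((m : ℤ) - 1) * e + (n - 1) * e = (k - 1) * e := by
        rw [← add_mul]; congr 1; omega
      rwa [h3] at h1⟩)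
    (fun f f' g => Subtype.ext (MultilinearMap.ext fun x => rfl))
    (fun c f g => Subtype.ext (MultilinearMap.ext fun x => rfl))
    (fun f g g' => Subtype.ext (MultilinearMap.ext fun x => by
      change f.1 (plug h i x (g.1 _ + g'.1 _)) = f.1 (plug h i x (g.1 _)) + f.1 (plug h i x (g'.1 _))
      rw [← update_plug V h i x 0, MultilinearMap.map_update_add, update_plug, update_plug]))
    (fun c f g => Subtype.ext (MultilinearMap.ext fun x => by
      change f.1 (plug h i x (c • g.1 _)) = c • f.1 (plug h i x (g.1 _))
      rw [← update_plug V h i x 0, MultilinearMap.map_update_smul, update_plug]))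
  act_one := fun f => Subtype.ext (multiMap_ext fun p x hx => by
    refine (endAct_apply V 1 f.1 p x hx).trans ?_
    rw [koszulExp_one, parSign, if_pos rfl, one_smul]
    rfl)
  act_mul := fun σ τ f => Subtype.ext (multiMap_ext fun p x hx => by
    refine (endAct_apply V (σ * τ) f.1 p x hx).trans ?_
    refine Eq.trans ?_ (endAct_apply V τ (endAct V σ f.1) p x hx).symm
    rw [endAct_apply V σ f.1 (fun i => p (τ⁻¹ i)) (fun i => x (τ⁻¹ i)) fun i => hx _, smul_smul,
      ← parSign_add, ← koszulExp_mul, mul_inv_rev]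
    rfl)
  comp_one := fun {m} i f => Subtype.ext (MultilinearMap.ext fun x => by
    change f.1 (plug rfl i x (x (innerPos rfl i 0))) = f.1 x
    congr 1
    funext a
    by_cases ha : a = i
    · subst ha; rw [plug_self]; congr 1
    · rw [plug_ne V _ i _ _ ha]
      congr 1
      rw [Fin.ext_iff, outerPos_val]
      split_ifs <;> omega)
  one_comp := fun {n} g => Subtype.ext (MultilinearMap.ext fun x => by
    refine (plug_self V (Nat.add_comm n 1) 0 x
      (g.1 fun b => x (innerPos (Nat.add_comm n 1) 0 b))).trans ?_
    congr 1
    funext b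
    congr 1
    rw [Fin.ext_iff, innerPos_val]
    simp)
  comp_nested := fun {m n l k₁ k₂ k} h₁ h h₂ h' i j f g p =>
    Subtype.ext (MultilinearMap.ext fun x => by
    have hj := j.2
    have hi := i.2
    change f.1 (plug h₁ i (plug h (innerPos h₁ i j) x (p.1 _)) (g.1 _)) =
      f.1 (plug h' i x (g.1 (plug h₂ j _ (p.1 _))))
    congr 1
    funext a
    by_cases ha : a = i
    · subst ha
      rw [plug_self, plug_self]
      congr 1
      funext b
      by_cases hb : b = j
      · subst hb
        rw [plug_self, plug_self]
        congr 1
        funext c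
        congr 1
        rw [Fin.ext_iff]
        simp only [innerPos_val]
        omega
      · rw [plug_ne V h _ _ _ (fun hh => hb ((innerPos_inj h₁ a).1 hh)), plug_ne V h₂ j _ _ hb]
        congr 1
        have hb' := Fin.val_ne_of_ne hb
        rw [Fin.ext_iff]
        simp only [innerPos_val, outerPos_val, Fin.lt_def]
        split_ifs <;> omega
    · rw [plug_ne V h₁ i _ _ ha, plug_ne V h' i _ _ ha,
        plug_ne V h _ _ _ (outerPos_ne_innerPos h₁ i ha j)]
      congr 1
      have ha' := Fin.val_ne_of_ne ha
      rw [Fin.ext_iff]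
      simp only [innerPos_val, outerPos_val, Fin.lt_def]
      split_ifs <;> omega)
  comp_parallel := fun {m n l k₁ k₂ k} h₁ h h₂ h' i j hij f g p =>
    Subtype.ext (MultilinearMap.ext fun x => by
    have hj := j.2
    have hi := i.2
    have hij' := Fin.val_ne_of_ne hij
    change f.1 (plug h₁ i (plug h (outerPos h₁ i j hij) x (p.1 _)) (g.1 _)) =
      f.1 (plug h₂ j (plug h' (outerPos h₂ j i hij.symm) x (g.1 _)) (p.1 _))
    congr 1
    funext a
    by_cases ha : a = i
    · subst ha
      rw [plug_self, plug_ne V h₂ j _ _ hij.symm, plug_self]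
      congr 1
      funext b
      have hb := b.2
      rw [plug_ne V h _ _ _ (outerPos_ne_innerPos h₁ a hij b).symm]
      congr 1
      rw [Fin.ext_iff]
      simp only [innerPos_val, outerPos_val, Fin.lt_def]
      split_ifs <;> omega
    · by_cases ha2 : a = j
      · subst ha2
        rw [plug_self, plug_ne V h₁ i _ _ ha, plug_self]
        congr 1
        funext b
        have hb := b.2
        rw [plug_ne V h' _ _ _ (outerPos_ne_innerPos h₂ a hij.symm b).symm]
        congr 1
        rw [Fin.ext_iff]
        simp only [innerPos_val, outerPos_val, Fin.lt_def]
        split_ifs <;> omega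
      · rw [plug_ne V h₁ i _ _ ha, plug_ne V h₂ j _ _ ha2,
          plug_ne V h _ _ _ (fun hh => ha2 ((outerPos_inj h₁ i ha hij).1 hh)),
          plug_ne V h' _ _ _ (fun hh => ha ((outerPos_inj h₂ j ha2 hij.symm).1 hh))]
        congr 1
        have ha' := Fin.val_ne_of_ne ha
        have ha2' := Fin.val_ne_of_ne ha2
        rw [Fin.ext_iff]
        simp only [outerPos_val, Fin.lt_def]
        split_ifs <;> omega)
  comp_act := fun {m n k} h i σ τ r hσ hτ f g => Subtype.ext (multiMap_ext fun p x hx => by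
    have hg := endAct_mem V τ g.2 _ _ fun b => hx (innerPos h i b)
    refine Eq.trans ?_ (endAct_apply V r (endComp V h (σ i) f.1 g.1) p x hx).symm
    change endAct V σ f.1 (plug h i x (endAct V τ g.1 fun b => x (innerPos h i b))) = _
    rw [endAct_apply V σ f.1 _ _ (plug_mem V h i hx hg),
      endAct_apply V τ g.1 _ _ fun b => hx (innerPos h i b)]
    have hplug : (fun a => plug h i x (parSign K (koszulExp τ fun b => (p (innerPos h i b) : ZMod 2)) •
        g.1 fun b => x (innerPos h i (τ⁻¹ b))) (σ⁻¹ a)) =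
        plug h (σ i) (fun c => x (r⁻¹ c))
          (parSign K (koszulExp τ fun b => (p (innerPos h i b) : ZMod 2)) •
            g.1 fun b => x (innerPos h i (τ⁻¹ b))) := by
      funext a
      obtain ⟨a, rfl⟩ := σ.surjective a
      rw [perm_inv_apply]
      by_cases ha : a = i
      · subst ha; rw [plug_self, plug_self]
      · rw [plug_ne V h i _ _ ha, plug_ne V h (σ i) _ _ (σ.injective.ne ha), ← hσ a ha,
          perm_inv_apply]
    rw [hplug, ← update_plug V h (σ i) _ 0, MultilinearMap.map_update_smul, update_plug, smul_smul,
      ← parSign_add, endComp_apply]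
    congr 2
    · refine (koszulExp_comp h i σ τ r hσ hτ (fun c => (p c : ZMod 2)) _ ?_ ?_).symm
      · intro a ha
        rw [dif_neg ha]
      · rw [dif_pos rfl]
        have h2 : (((n - 1) * e : ℤ) : ZMod 2) = 0 := by
          rw [ZMod.intCast_eq_zero_iff_even]
          exact he.mul_left _
        rw [Int.cast_add, h2, add_zero, Int.cast_sum]
    · congr 2
      funext b
      obtain ⟨b, rfl⟩ := τ.surjective b
      rw [← hτ, perm_inv_apply, perm_inv_apply])

end Endomorphisms

section Algebras

variable {K : Type u} [Field K]

/-- The value of an operation on a tuple of elements. -/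
def endApply {V : GradedSpace.{u, w} K} {e : ℤ} {he : Even e} {n : ℕ}
    (f : (endOperad V e he).obj n) (x : Fin n → V.carrier) : V.carrier :=
  Subtype.val (p := fun f : MultiMap V n => f ∈ homogeneousMaps V n ((n - 1) * e)) f x

/-- A structure of algebra over the binary quadratic operad `P(E, R)`, with `E` placed in the even
degree `e`, on the graded vector space `V`: a representation `P(E, R) → End(V)`. -/
abbrev AlgebraOn (P : QuadraticData.{u, v} K) (V : GradedSpace.{u, w} K) (e : ℤ) (he : Even e) :=
  Hom P.operad.toPreOperad (endOperad V e he).toPreOperad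

/-- The binary multiplication `[x, y]` of an algebra that is given by an element of `E`. -/
def AlgebraOn.bracket {P : QuadraticData.{u, v} K} {V : GradedSpace.{u, w} K} {e : ℤ} {he : Even e}
    (rep : AlgebraOn P V e he) (μ : P.E) (x y : V.carrier) : V.carrier :=
  endApply (rep.app 2 (P.gen μ)) ![x, y]

/-- A differential graded algebra over `P(E, R)`, with `E` in the even degree `e` and with a
differential of odd degree `q`: all operations of the algebra commute with the differential in
the graded sense. -/
structure DGAlgebra (P : QuadraticData.{u, v} K) (e q : ℤ) (he : Even e) where
  /-- the underlying graded vector space -/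
  V : GradedSpace.{u, w} K
  /-- the algebra structure -/
  rep : AlgebraOn P V e he
  /-- the differential -/
  d : V.carrier →ₗ[K] V.carrier
  d_mem : ∀ (i : ℤ) (x : V.carrier), x ∈ V.deg i → d x ∈ V.deg (i + q)
  d_d : ∀ x : V.carrier, d (d x) = 0
  d_op : ∀ {n : ℕ} (f : P.operad.obj n) (p : Fin n → ℤ) (x : Fin n → V.carrier),
    (∀ i, x i ∈ V.deg (p i)) →
    d (endApply (rep.app n f) x) = ∑ i, (-1 : K) ^ (∑ j with j < i, p j) •
      endApply (rep.app n f) (Function.update x i (d (x i)))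

/-- The shifted space `sV`, with `(sV)ᵢ = V_{i-1}`. -/
def GradedSpace.shift (V : GradedSpace.{u, w} K) : GradedSpace.{u, w} K where
  carrier := V.carrier
  deg := fun i => V.deg (i - 1)
  isInternal := by
    have h := (DirectSum.isInternal_submodule_iff_iSupIndep_and_iSup_eq_top V.deg).1 V.isInternal
    refine (DirectSum.isInternal_submodule_iff_iSupIndep_and_iSup_eq_top _).2
      ⟨h.1.comp (sub_left_injective (b := (1 : ℤ))), ?_⟩
    rw [← h.2]
    exact (Equiv.subRight (1 : ℤ)).surjective.iSup_comp V.deg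

/-- The degree shifting operator `s : V → sV`, of degree `+1`. -/
def GradedSpace.s (V : GradedSpace.{u, w} K) : V.carrier ≃ₗ[K] V.shift.carrier :=
  LinearEquiv.refl K V.carrier

theorem even_derived {e q : ℤ} (he : Even e) (hq : Odd q) : Even (e + q - 1) :=
  (he.add_odd hq).sub_odd odd_one

end Algebras

end DerivedBrackets

end

/-!
The operad `Perm` has an `n`-dimensional space of operations of arity `n`, with one basis vector
`eₙⁱ` for each choice of a marked input `i`, and `eₘᵃ ∘ᵢ eₙᵇ` marks the input `b` of the inner
operation if `a = i`, and the input `a` of the outer one otherwise. For an operation `f` of the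
dg algebra `A`, the derived operation with marked input `i` is
`s ∘ f ∘ (d s⁻¹ ⊗ ⋯ ⊗ s⁻¹ ⊗ ⋯ ⊗ d s⁻¹)`, with the bare `s⁻¹` at the place `i`: all inputs but the
marked one are differentiated. As `d s⁻¹` is even and `s⁻¹` is odd, its Koszul sign is
`(-1) ^ (|s x₁| + ⋯ + |s xᵢ₋₁|)`. For `n = 2` these are the two derived brackets.

The point is that `eₙⁱ ⊗ f ↦` (derived operation) is a morphism of operads
`Perm ⊗ P → End(sA)` (`derivedHom`). It respects a composition `f ∘ᵢ g` at the marked input of `f`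
by inspection (`derivedMap_comp_inner`). At any other input, `g` is differentiated as a whole; in
the Leibniz expansion of `d (g (d x₁, …, x_b, …, d xₙ))` every summand but one contains `d² = 0`,
and the remaining one has all inputs differentiated (`derivedMap_comp_outer`). Equivariance is the
computation of how the Koszul sign changes when the parity of one entry is switched
(`koszulExp_shift`).

The required morphism is then induced by the composite
`F(E_Perm ⊗ E) → F(E_Perm) ⊗ F(E) → Perm ⊗ P → End(sA)`, which begins with `Φ`: the second map
kills `R_Perm ⊗ F(E)(3) + F(E_Perm)(3) ⊗ R` (`Hom.tensor_whiteRel`), hence the composite kills the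
relations of the white product.
-/

noncomputable section

namespace DerivedBrackets

universe u v w v₁ v₂ w₁ w₂

/-! ### Morphisms of operads and tensor products -/

section Morphisms

variable {K : Type u} [Field K]

/-- The composite of two morphisms of operads. -/
def Hom.trans {P : PreOperad.{u, v} K} {Q : PreOperad.{u, w} K} {T : PreOperad.{u, v₁} K}
    (φ : Hom P Q) (ψ : Hom Q T) : Hom P T where
  app := fun n => ψ.app n ∘ₗ φ.app n
  map_one := by rw [LinearMap.comp_apply, φ.map_one, ψ.map_one]
  map_act := fun σ f => by simp only [LinearMap.comp_apply, φ.map_act, ψ.map_act]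
  map_comp := fun h i f g => by simp only [LinearMap.comp_apply, φ.map_comp, ψ.map_comp]

/-- The tensor product of two morphisms of operads. -/
def Hom.tensor {P : Operad.{u, v₁} K} {Q : Operad.{u, v₂} K} {P' : Operad.{u, w₁} K}
    {Q' : Operad.{u, w₂} K} (φ : Hom P.toPreOperad P'.toPreOperad)
    (ψ : Hom Q.toPreOperad Q'.toPreOperad) :
    Hom (tensorOperad P Q).toPreOperad (tensorOperad P' Q').toPreOperad where
  app := fun n => TensorProduct.map (φ.app n) (ψ.app n)
  map_one := by
    change TensorProduct.map _ _ (P.one ⊗ₜ[K] Q.one) = P'.one ⊗ₜ[K] Q'.one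
    rw [TensorProduct.map_tmul, φ.map_one, ψ.map_one]
  map_act := by
    intro n σ f
    change TensorProduct.map (φ.app n) (ψ.app n) (TensorProduct.map (P.act σ) (Q.act σ) f) =
      TensorProduct.map (P'.act σ) (Q'.act σ) (TensorProduct.map (φ.app n) (ψ.app n) f)
    change P.obj n ⊗[K] Q.obj n at f
    induction f with
    | zero => simp only [map_zero]
    | add x y hx hy => simp only [map_add, hx, hy]
    | tmul f f' => simp [φ.map_act, ψ.map_act]
  map_comp := by
    intro m n k h i f g
    change TensorProduct.map (φ.app k) (ψ.app k)
        (TensorProduct.map₂ (P.comp h i) (Q.comp h i) f g) =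
      TensorProduct.map₂ (P'.comp h i) (Q'.comp h i) (TensorProduct.map (φ.app m) (ψ.app m) f)
        (TensorProduct.map (φ.app n) (ψ.app n) g)
    change P.obj m ⊗[K] Q.obj m at f
    change P.obj n ⊗[K] Q.obj n at g
    induction f with
    | zero => simp only [map_zero, LinearMap.zero_apply]
    | add x y hx hy => simp only [map_add, LinearMap.add_apply, hx, hy]
    | tmul f f' =>
    induction g with
    | zero => simp only [map_zero]
    | add x y hx hy => simp only [map_add, hx, hy]
    | tmul g g' => simp [φ.map_comp, ψ.map_comp]

/-- A morphism out of a tensor product of operads, from a compatible family of bilinear maps. -/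
def Hom.ofPairing {P : Operad.{u, v₁} K} {Q : Operad.{u, v₂} K} {T : Operad.{u, w} K}
    (β : ∀ n, P.obj n →ₗ[K] Q.obj n →ₗ[K] T.obj n) (h_one : β 1 P.one Q.one = T.one)
    (h_act : ∀ {n : ℕ} (σ : Equiv.Perm (Fin n)) (f : P.obj n) (g : Q.obj n),
      β n (P.act σ f) (Q.act σ g) = T.act σ (β n f g))
    (h_comp : ∀ {m n k : ℕ} (h : k + 1 = m + n) (i : Fin m) (f : P.obj m) (f' : P.obj n)
      (g : Q.obj m) (g' : Q.obj n),
      β k (P.comp h i f f') (Q.comp h i g g') = T.comp h i (β m f g) (β n f' g')) :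
    Hom (tensorOperad P Q).toPreOperad T.toPreOperad where
  app := fun n => TensorProduct.lift (β n)
  map_one := (TensorProduct.lift.tmul _ _).trans h_one
  map_act := by
    intro n σ f
    change TensorProduct.lift (β n) (TensorProduct.map (P.act σ) (Q.act σ) f) =
      T.act σ (TensorProduct.lift (β n) f)
    change P.obj n ⊗[K] Q.obj n at f
    induction f with
    | zero => simp only [map_zero]
    | add x y hx hy => simp only [map_add, hx, hy]
    | tmul f f' => simp [h_act]
  map_comp := by
    intro m n k h i f g
    change TensorProduct.lift (β k) (TensorProduct.map₂ (P.comp h i) (Q.comp h i) f g) =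
      T.comp h i (TensorProduct.lift (β m) f) (TensorProduct.lift (β n) g)
    change P.obj m ⊗[K] Q.obj m at f
    change P.obj n ⊗[K] Q.obj n at g
    induction f with
    | zero => simp only [map_zero, LinearMap.zero_apply]
    | add x y hx hy => simp only [map_add, LinearMap.add_apply, hx, hy]
    | tmul f f' =>
    induction g with
    | zero => simp only [map_zero]
    | add x y hx hy => simp only [map_add, hx, hy]
    | tmul g g' => simp [h_comp]

/-- If `φ` and `ψ` kill the relations of `P` and of `Q`, then `φ ⊗ ψ` kills the subspace whose
preimage under `Φ` defines the white product. -/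
theorem Hom.tensor_whiteRel {P : QuadraticData.{u, v₁} K} {Q : QuadraticData.{u, v₂} K}
    {P' : Operad.{u, w₁} K} {Q' : Operad.{u, w₂} K}
    (φ : Hom (freeOperad P.ρ).toPreOperad P'.toPreOperad)
    (ψ : Hom (freeOperad Q.ρ).toPreOperad Q'.toPreOperad)
    (hφ : ∀ x ∈ P.R, φ.app 3 x = 0) (hψ : ∀ y ∈ Q.R, ψ.app 3 y = 0)
    {t : (tensorOperad (freeOperad P.ρ) (freeOperad Q.ρ)).obj 3} (ht : t ∈ whiteRel P Q) :
    (φ.tensor ψ).app 3 t = 0 := by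
  refine (sup_le (c := LinearMap.ker ((φ.tensor ψ).app 3)) ?_ ?_) ht
  · rintro _ ⟨t, rfl⟩
    have h0 : φ.app 3 ∘ₗ P.R.subtype = 0 := LinearMap.ext fun x => hφ x x.2
    have h : TensorProduct.map (φ.app 3) (ψ.app 3) ∘ₗ
        TensorProduct.map P.R.subtype LinearMap.id = 0 := by
      rw [← TensorProduct.map_comp, h0, TensorProduct.map_zero_left]
    exact LinearMap.congr_fun h t
  · rintro _ ⟨t, rfl⟩
    have h0 : ψ.app 3 ∘ₗ Q.R.subtype = 0 := LinearMap.ext fun y => hψ y y.2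
    have h : TensorProduct.map (φ.app 3) (ψ.app 3) ∘ₗ
        TensorProduct.map LinearMap.id Q.R.subtype = 0 := by
      rw [← TensorProduct.map_comp, h0, TensorProduct.map_zero_right]
    exact LinearMap.congr_fun h t

end Morphisms

/-! ### The operad of permutation algebras -/

section Perm

theorem pos_ext {m n k : ℕ} (h : k + 1 = m + n) (i : Fin m) {X : Type*} {f g : Fin k → X}
    (ho : ∀ (a : Fin m) (ha : a ≠ i), f (outerPos h i a ha) = g (outerPos h i a ha))
    (hi : ∀ b : Fin n, f (innerPos h i b) = g (innerPos h i b)) : f = g := by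
  funext c
  rcases pos_cases h i c with ⟨a, ha, rfl⟩ | ⟨b, rfl⟩
  · exact ho a ha
  · exact hi b

variable (K : Type u) [Field K]

variable {K} in
/-- The partial composition of `Perm` on coordinate vectors. On basis vectors, `e_a ∘ᵢ e_b` is the
basis vector of the outer input `a` if `a ≠ i`, and of the inner input `b` if `a = i`. -/
def permComp {m n k : ℕ} (h : k + 1 = m + n) (i : Fin m) (v : Fin m → K) (w : Fin n → K) :
    Fin k → K :=
  fun c => Sum.elim (fun a : {a : Fin m // a ≠ i} => v a.1 * ∑ b, w b) (fun b => v i * w b)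
    ((posEquiv h i).symm c)

variable {K}

theorem permComp_outer {m n k : ℕ} (h : k + 1 = m + n) (i : Fin m) (v : Fin m → K)
    (w : Fin n → K) (a : Fin m) (ha : a ≠ i) :
    permComp h i v w (outerPos h i a ha) = v a * ∑ b, w b := by
  rw [permComp, ← posEquiv_inl h i ⟨a, ha⟩, Equiv.symm_apply_apply, Sum.elim_inl]

theorem permComp_inner {m n k : ℕ} (h : k + 1 = m + n) (i : Fin m) (v : Fin m → K)
    (w : Fin n → K) (b : Fin n) :
    permComp h i v w (innerPos h i b) = v i * w b := by
  rw [permComp, ← posEquiv_inr h i b, Equiv.symm_apply_apply, Sum.elim_inr]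

theorem sum_permComp {m n k : ℕ} (h : k + 1 = m + n) (i : Fin m) (v : Fin m → K)
    (w : Fin n → K) : ∑ c, permComp h i v w c = (∑ a, v a) * ∑ b, w b := by
  rw [sum_pos h i, sum_ne i v, add_mul, Finset.sum_mul, Finset.mul_sum]
  simp only [permComp_outer, permComp_inner]

variable (K) in
/-- The operad `Perm`, with `Kⁿ` in arity `n`: the `i`-th basis vector is the monomial of arity `n`
whose marked input is `i`, all other inputs being interchangeable. -/
def permOperad : Operad.{u, u} K where
  obj := fun n => Fin n → K
  one := fun _ => 1
  act := fun σ => LinearMap.funLeft K K σ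
  comp := fun h i => LinearMap.mk₂ K (permComp h i)
    (fun v v' w => pos_ext h i
      (fun a ha => by simp only [permComp_outer, Pi.add_apply, add_mul])
      (fun b => by simp only [permComp_inner, Pi.add_apply, add_mul]))
    (fun c v w => pos_ext h i
      (fun a ha => by simp only [permComp_outer, Pi.smul_apply, smul_eq_mul, mul_assoc])
      (fun b => by simp only [permComp_inner, Pi.smul_apply, smul_eq_mul, mul_assoc]))
    (fun v w w' => pos_ext h i
      (fun a ha => by simp only [permComp_outer, Pi.add_apply, Finset.sum_add_distrib, mul_add])
      (fun b => by simp only [permComp_inner, Pi.add_apply, mul_add]))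
    (fun c v w => pos_ext h i
      (fun a ha => by
        simp only [permComp_outer, Pi.smul_apply, smul_eq_mul, ← Finset.mul_sum, mul_left_comm])
      (fun b => by simp only [permComp_inner, Pi.smul_apply, smul_eq_mul, mul_left_comm]))
  act_one := fun f => rfl
  act_mul := fun σ τ f => rfl
  comp_one := fun {m} i f => pos_ext rfl i
    (fun a ha => by
      refine (permComp_outer rfl i f (fun _ => 1) a ha).trans ?_
      have : outerPos (rfl : m + 1 = m + 1) i a ha = a := by
        rw [Fin.ext_iff, outerPos_val]
        split_ifs <;> omega
      rw [this]
      simp)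
    (fun b => by
      refine (permComp_inner rfl i f (fun _ => 1) b).trans ?_
      have : innerPos (rfl : m + 1 = m + 1) i b = i := by
        rw [Fin.ext_iff, innerPos_val]
        omega
      rw [this, mul_one])
  one_comp := fun {n} g => pos_ext (Nat.add_comm n 1) 0
    (fun a ha => absurd (Subsingleton.elim _ _) ha)
    (fun b => by
      refine (permComp_inner (Nat.add_comm n 1) 0 (fun _ => 1) g b).trans ?_
      have : innerPos (Nat.add_comm n 1) 0 b = b := by
        rw [Fin.ext_iff, innerPos_val]
        simp
      rw [this, one_mul])
  comp_nested := fun {m n l k₁ k₂ k} h₁ h h₂ h' i j f g p => by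
    change permComp h (innerPos h₁ i j) (permComp h₁ i f g) p =
      permComp h' i f (permComp h₂ j g p)
    have hj := j.2
    have hi := i.2
    refine pos_ext h (innerPos h₁ i j) (fun c hc => ?_) fun c => ?_
    · rw [permComp_outer]
      rcases pos_cases h₁ i c with ⟨a, ha, rfl⟩ | ⟨b, rfl⟩
      · have : outerPos h (innerPos h₁ i j) (outerPos h₁ i a ha) hc = outerPos h' i a ha := by
          have ha' := Fin.val_ne_of_ne ha
          rw [Fin.ext_iff]
          simp only [innerPos_val, outerPos_val, Fin.lt_def]
          split_ifs <;> omega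
        rw [this, permComp_outer, permComp_outer, sum_permComp, mul_assoc]
      · have hb : b ≠ j := fun hb => hc (by rw [hb])
        have : outerPos h (innerPos h₁ i j) (innerPos h₁ i b) hc =
            innerPos h' i (outerPos h₂ j b hb) := by
          have hb' := Fin.val_ne_of_ne hb
          rw [Fin.ext_iff]
          simp only [innerPos_val, outerPos_val, Fin.lt_def]
          split_ifs <;> omega
        rw [this, permComp_inner, permComp_inner, permComp_outer, mul_assoc]
    · have : innerPos h (innerPos h₁ i j) c = innerPos h' i (innerPos h₂ j c) := by
        rw [Fin.ext_iff]
        simp only [innerPos_val]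
        omega
      rw [permComp_inner, this, permComp_inner, permComp_inner, permComp_inner, mul_assoc]
  comp_parallel := fun {m n l k₁ k₂ k} h₁ h h₂ h' i j hij f g p => by
    change permComp h (outerPos h₁ i j hij) (permComp h₁ i f g) p =
      permComp h' (outerPos h₂ j i hij.symm) (permComp h₂ j f p) g
    have hj := j.2
    have hi := i.2
    have hij' := Fin.val_ne_of_ne hij
    refine pos_ext h (outerPos h₁ i j hij) (fun c hc => ?_) fun c => ?_
    · rw [permComp_outer]
      rcases pos_cases h₁ i c with ⟨a, ha, rfl⟩ | ⟨b, rfl⟩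
      · have haj : a ≠ j := fun haj => hc (by subst haj; rfl)
        have ha' := Fin.val_ne_of_ne ha
        have haj' := Fin.val_ne_of_ne haj
        have : outerPos h (outerPos h₁ i j hij) (outerPos h₁ i a ha) hc =
            outerPos h' (outerPos h₂ j i hij.symm) (outerPos h₂ j a haj)
              (fun hh => ha ((outerPos_inj h₂ j haj hij.symm).1 hh)) := by
          rw [Fin.ext_iff]
          simp only [outerPos_val, Fin.lt_def]
          split_ifs <;> omega
        rw [this, permComp_outer, permComp_outer, permComp_outer, mul_right_comm]
      · have hb := b.2
        have : outerPos h (outerPos h₁ i j hij) (innerPos h₁ i b) hc =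
            innerPos h' (outerPos h₂ j i hij.symm) b := by
          rw [Fin.ext_iff]
          simp only [innerPos_val, outerPos_val, Fin.lt_def]
          split_ifs <;> omega
        rw [this, permComp_inner, permComp_inner, permComp_outer, mul_right_comm]
    · have hc := c.2
      have : innerPos h (outerPos h₁ i j hij) c = outerPos h' (outerPos h₂ j i hij.symm)
          (innerPos h₂ j c) (outerPos_ne_innerPos h₂ j hij.symm c).symm := by
        rw [Fin.ext_iff]
        simp only [innerPos_val, outerPos_val, Fin.lt_def]
        split_ifs <;> omega
      rw [permComp_inner, this, permComp_outer, permComp_outer, permComp_inner, mul_right_comm]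
  comp_act := fun {m n k} h i σ τ r hσ hτ f g => by
    change permComp h i (fun a => f (σ a)) (fun b => g (τ b)) =
      fun c => permComp h (σ i) f g (r c)
    refine pos_ext h i (fun a ha => ?_) fun b => ?_
    · rw [permComp_outer, hσ, permComp_outer, Equiv.sum_comp τ]
    · rw [permComp_inner, hτ, permComp_inner]

variable (K) in
/-- The morphism to `Perm` from the free operad on its generators. -/
def permProj : Hom (freeOperad (permRep K)).toPreOperad (permOperad K).toPreOperad :=
  freeLift (permRep K) (permOperad K) LinearMap.id fun _ _ => rfl

theorem permProj_gen (v : Fin 2 → K) : (permProj K).app 2 (freeGen (permRep K) v) = v :=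
  freeLift_gen _ _ _ _ v

theorem permProj_relation {x : (freeOperad (permRep K)).obj 3} (hx : x ∈ (permData K).R) :
    (permProj K).app 3 x = 0 := by
  refine (Submodule.span_le (p := LinearMap.ker ((permProj K).app 3))).2 ?_ hx
  have hassoc : (permProj K).app 3 (permAssoc K) = 0 := by
    rw [permAssoc, map_sub, Hom.map_comp, Hom.map_comp, permProj_gen]
    refine sub_eq_zero.2 ?_
    change permComp (m := 2) (n := 2) (k := 3) rfl 0 _ _ =
      permComp (m := 2) (n := 2) (k := 3) rfl 1 _ _
    refine pos_ext (m := 2) (n := 2) rfl 1 (fun a ha => ?_) fun b => ?_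
    · obtain rfl : a = 0 := by omega
      rw [permComp_outer]
      refine (permComp_inner (m := 2) (n := 2) (k := 3) rfl 0 (permGen K 1)
          (permGen K 1) 0).trans ?_
      simp [permGen]
    · rw [permComp_inner]
      fin_cases b
      · refine (permComp_inner (m := 2) (n := 2) (k := 3) rfl 0 (permGen K 1)
          (permGen K 1) 1).trans ?_
        simp [permGen]
      · refine (permComp_outer (m := 2) (n := 2) (k := 3) rfl 0 (permGen K 1)
          (permGen K 1) 1 (by decide)).trans ?_
        simp [permGen]
  have hcomm : (permProj K).app 3 (permComm K) = 0 := by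
    rw [permComm, map_sub, Hom.map_comp, Hom.map_comp, permProj_gen, permProj_gen]
    refine sub_eq_zero.2 ?_
    change permComp (m := 2) (n := 2) (k := 3) rfl 0 _ _ =
      permComp (m := 2) (n := 2) (k := 3) rfl 0 _ _
    refine pos_ext (m := 2) (n := 2) rfl 0 (fun a ha => ?_) fun b => ?_
    · rw [permComp_outer, permComp_outer]
      simp [permGen]
    · rw [permComp_inner, permComp_inner]
      simp [permGen]
  rintro _ ⟨σ, rfl | rfl⟩
  · exact ((permProj K).map_act σ _).trans (by rw [hassoc, map_zero])
  · exact ((permProj K).map_act σ _).trans (by rw [hcomm, map_zero])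

end Perm

/-! ### Koszul signs -/

section Parity

variable {K : Type u} [Field K]

theorem parSign_intCast (n : ℤ) : parSign K (n : ZMod 2) = (-1 : K) ^ n := by
  rcases Int.even_or_odd n with h | h
  · rw [h.neg_one_zpow, parSign, if_pos ((ZMod.intCast_eq_zero_iff_even).2 h)]
  · rw [h.neg_one_zpow, parSign, if_neg]
    rwa [ZMod.intCast_eq_zero_iff_even, Int.not_even_iff_odd]

theorem parSign_sum {ι : Type*} (t : Finset ι) (a : ι → ZMod 2) :
    parSign K (∑ i ∈ t, a i) = ∏ i ∈ t, parSign K (a i) := by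
  classical
  induction t using Finset.induction_on with
  | empty => simp [parSign]
  | insert i t hi ih => rw [Finset.sum_insert hi, Finset.prod_insert hi, parSign_add, ih]

/-- The parity operator `x ↦ (-1) ^ |x| x`. -/
def parityMap (V : GradedSpace.{u, w} K) : V.carrier →ₗ[K] V.carrier :=
  parityProj V 0 - parityProj V 1

theorem parityMap_of_mem (V : GradedSpace.{u, w} K) {i : ℤ} {x : V.carrier} (hx : x ∈ V.deg i) :
    parityMap V x = parSign K (i : ZMod 2) • x := by
  rw [parityMap, LinearMap.sub_apply, parityProj_of_mem V _ hx, parityProj_of_mem V _ hx, parSign]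
  rcases zmod_two_cases (i : ZMod 2) with h | h <;> simp [h]

/-- The total parity of the entries before the place `i`, which is the Koszul sign exponent for
moving an odd operator to that place. -/
def sumBefore {n : ℕ} (i : Fin n) (p : Fin n → ZMod 2) : ZMod 2 :=
  ∑ j, if j < i then p j else 0

theorem sumBefore_outer {m n k : ℕ} (h : k + 1 = m + n) (i a : Fin m) (ha : a ≠ i)
    (p : Fin k → ZMod 2) (q : Fin m → ZMod 2)
    (hq : ∀ (a : Fin m) (ha : a ≠ i), q a = p (outerPos h i a ha))
    (hqi : q i = ∑ b, p (innerPos h i b)) :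
    sumBefore (outerPos h i a ha) p = sumBefore a q := by
  unfold sumBefore
  rw [sum_pos h i, sum_ne i]
  simp only [outerPos_lt_outerPos, innerPos_lt_outerPos]
  congr 1
  · exact Finset.sum_congr rfl fun c _ => by rw [hq c.1 c.2]
  · split_ifs
    · rw [hqi]
    · simp

theorem sumBefore_inner {m n k : ℕ} (h : k + 1 = m + n) (i : Fin m) (b : Fin n)
    (p : Fin k → ZMod 2) (q : Fin m → ZMod 2)
    (hq : ∀ (a : Fin m) (ha : a ≠ i), q a = p (outerPos h i a ha)) :
    sumBefore (innerPos h i b) p = sumBefore i q + sumBefore b fun b => p (innerPos h i b) := by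
  unfold sumBefore
  rw [sum_pos h i, sum_ne i]
  simp only [outerPos_lt_innerPos, innerPos_lt_innerPos, lt_irrefl, if_false, add_zero]
  congr 1
  exact Finset.sum_congr rfl fun c _ => by rw [hq c.1 c.2]

/-- The change of the Koszul sign when the parity of the entry `i` is switched: switching before
or after the permutation differs by the signs for moving an odd symbol to the place `i`, or to the
place `σ i` of the permuted entries. -/
theorem koszulExp_shift {n : ℕ} (σ : Equiv.Perm (Fin n)) (i : Fin n) (p q : Fin n → ZMod 2)
    (hq : ∀ j, j ≠ i → q j = p j) (hqi : q i = p i + 1) :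
    sumBefore i p + koszulExp σ q =
      koszulExp σ p + sumBefore (σ i) fun j => p (σ⁻¹ j) := by
  have hch : ∀ a : ZMod 2, a + a = 0 := by decide
  have hs : sumBefore (σ i) (fun j => p (σ⁻¹ j)) = ∑ j, if σ j < σ i then p j else 0 := by
    unfold sumBefore
    rw [← Equiv.sum_comp σ]
    simp only [perm_inv_apply]
  have hk : koszulExp σ q = koszulExp σ p +
      ∑ j, if (i < j ∧ σ j < σ i) ∨ (j < i ∧ σ i < σ j) then p j else 0 := by
    -- the inversions that involve `i` as the second, and as the first entry
    have hi : ∀ a, (∑ b, if a < b ∧ σ b < σ a then q a * q b else 0) =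
        (∑ b, if a < b ∧ σ b < σ a then p a * p b else 0) +
          (if a < i ∧ σ i < σ a then p a else 0) +
          if a = i then ∑ b, if i < b ∧ σ b < σ i then p b else 0 else 0 := by
      intro a
      by_cases ha : a = i
      · subst ha
        rw [if_pos rfl, if_neg (fun h => lt_irrefl _ h.1), add_zero, ← Finset.sum_add_distrib]
        refine Finset.sum_congr rfl fun b _ => ?_
        split_ifs with hb
        · rw [hqi, hq b hb.1.ne', add_mul, one_mul]
        · rw [add_zero]
      · rw [if_neg ha, add_zero, sum_ne i, sum_ne i (fun b => ite _ (p a * p b) _), add_assoc]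
        congr 1
        · exact Finset.sum_congr rfl fun b _ => by rw [hq a ha, hq b.1 b.2]
        · split_ifs
          · rw [hq a ha, hqi, mul_add, mul_one]
          · rw [add_zero]
    unfold koszulExp
    rw [Finset.sum_congr rfl fun a _ => hi a, Finset.sum_add_distrib, Finset.sum_add_distrib,
      Finset.sum_ite_eq' Finset.univ i, if_pos (Finset.mem_univ i), add_assoc,
      ← Finset.sum_add_distrib]
    congr 1
    refine Finset.sum_congr rfl fun b _ => ?_
    rcases lt_trichotomy b i with h | h | h
    · simp [h, h.not_gt]
    · simp [h]
    · simp [h, h.not_gt]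
  rw [hs, hk, add_left_comm]
  congr 1
  unfold sumBefore
  rw [← Finset.sum_add_distrib]
  refine Finset.sum_congr rfl fun j _ => ?_
  rcases eq_or_ne j i with rfl | hj
  · simp
  have hσ : σ j ≠ σ i := σ.injective.ne hj
  rcases lt_or_gt_of_ne hj with h | h <;> rcases lt_or_gt_of_ne hσ with h' | h' <;>
    simp [h, h', h.not_gt, h'.not_gt, hch]

end Parity

/-! ### The multilinear maps of an algebra -/

section Multi

variable {K : Type u} [Field K] {P : QuadraticData.{u, v} K} {V : GradedSpace.{u, w} K} {e : ℤ}
  {he : Even e} (rep : AlgebraOn P V e he)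

/-- The operations of an algebra, as plain multilinear maps. -/
def AlgebraOn.multi (n : ℕ) : P.operad.obj n →ₗ[K] MultiMap V n :=
  (homogeneousMaps V n ((n - 1) * e)).subtype ∘ₗ
    (rep.app n : P.operad.obj n →ₗ[K] homogeneousMaps V n ((n - 1) * e))

theorem AlgebraOn.multi_mem {n : ℕ} (f : P.operad.obj n) :
    rep.multi n f ∈ homogeneousMaps V n ((n - 1) * e) :=
  (rep.app n f : homogeneousMaps V n ((n - 1) * e)).2

theorem AlgebraOn.multi_act {n : ℕ} (σ : Equiv.Perm (Fin n)) (f : P.operad.obj n) :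
    rep.multi n (P.operad.act σ f) = endAct V σ (rep.multi n f) :=
  congrArg (fun g : homogeneousMaps V n ((n - 1) * e) => g.1) (rep.map_act σ f)

theorem AlgebraOn.multi_comp {m n k : ℕ} (h : k + 1 = m + n) (i : Fin m) (f : P.operad.obj m)
    (g : P.operad.obj n) :
    rep.multi k (P.operad.comp h i f g) = endComp V h i (rep.multi m f) (rep.multi n g) :=
  congrArg (fun g : homogeneousMaps V k ((k - 1) * e) => g.1) (rep.map_comp h i f g)

theorem AlgebraOn.multi_one (x : Fin 1 → V.carrier) : rep.multi 1 P.operad.one x = x 0 :=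
  congrArg (fun g : homogeneousMaps V 1 (((1 : ℕ) - 1) * e) => g.1 x) rep.map_one

end Multi

/-! ### Derived operations -/

section Derived

variable {K : Type u} [Field K] (V : GradedSpace.{u, w} K) (d : V.carrier →ₗ[K] V.carrier)

variable {V} in
/-- The entries `d s⁻¹ xⱼ`, except for the marked one, which is `s⁻¹ xᵢ`. -/
def marked {n : ℕ} (i : Fin n) (x : Fin n → V.shift.carrier) : Fin n → V.carrier :=
  fun j => if j = i then V.s.symm (x j) else d (V.s.symm (x j))

/-- The derived operation `s ∘ f ∘ (d s⁻¹ ⊗ ⋯ ⊗ s⁻¹ ⊗ ⋯ ⊗ d s⁻¹)` with marked input `i`. Its Koszul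
sign is encoded by the parity operator of `sV` on the inputs before `i`, so that the formula makes
sense for inhomogeneous elements; see `derivedMap_apply`. -/
def derivedMap {n : ℕ} (i : Fin n) : MultiMap V n →ₗ[K] MultiMap V.shift n where
  toFun := fun f => V.s.toLinearMap.compMultilinearMap (f.compLinearMap fun j =>
    if j = i then V.s.symm.toLinearMap
    else if j < i then d ∘ₗ V.s.symm.toLinearMap ∘ₗ parityMap V.shift
    else d ∘ₗ V.s.symm.toLinearMap)
  map_add' := fun _ _ => MultilinearMap.ext fun _ => map_add V.s _ _
  map_smul' := fun c _ => MultilinearMap.ext fun _ => map_smul V.s c _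

/-- The inputs from the marked one on may be inhomogeneous. -/
theorem derivedMap_apply {n : ℕ} (i : Fin n) (f : MultiMap V n) (p : Fin n → ℤ)
    (x : Fin n → V.shift.carrier) (hx : ∀ j, j < i → x j ∈ V.shift.deg (p j)) :
    derivedMap V d i f x =
      parSign K (sumBefore i fun j => (p j : ZMod 2)) • V.s (f (marked d i x)) := by
  rw [sumBefore, parSign_sum, ← map_smul, ← f.map_smul_univ]
  refine congrArg V.s (congrArg f (funext fun j => ?_))
  beta_reduce
  rcases lt_trichotomy j i with h | h | h
  · rw [if_neg h.ne, if_pos h, if_pos h, marked, if_neg h.ne]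
    simp only [LinearMap.comp_apply]
    rw [parityMap_of_mem V.shift (hx j h)]
    simp
  · simp [h, marked, parSign]
  · simp [h.ne', h.not_gt, marked, parSign]

variable {V d} {q : ℤ}

theorem marked_mem {n : ℕ}
    (hd : ∀ (i : ℤ) (x : V.carrier), x ∈ V.deg i → d x ∈ V.deg (i + q))
    (i : Fin n) {p : Fin n → ℤ} {x : Fin n → V.shift.carrier}
    (hx : ∀ j, x j ∈ V.shift.deg (p j)) (j : Fin n) :
    marked d i x j ∈ V.deg (if j = i then p j - 1 else p j - 1 + q) := by
  rw [marked]
  split_ifs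
  · exact hx j
  · exact hd _ _ (hx j)

theorem derivedMap_mem {n : ℕ}
    (hd : ∀ (i : ℤ) (x : V.carrier), x ∈ V.deg i → d x ∈ V.deg (i + q))
    (i : Fin n) {e : ℤ} {f : MultiMap V n}
    (hf : f ∈ homogeneousMaps V n ((n - 1) * e)) :
    derivedMap V d i f ∈ homogeneousMaps V.shift n ((n - 1) * (e + q - 1)) := by
  intro p x hx
  rw [derivedMap_apply V d i f p x fun j _ => hx j]
  refine Submodule.smul_mem _ _ ?_
  have h := hf _ _ (marked_mem hd i hx)
  change f (marked d i x) ∈ V.deg (_ - 1)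
  convert h using 2
  have h1 : ∀ j, (if j = i then p j - 1 else p j - 1 + q) =
      p j + (q - 1) - if j = i then q else 0 := by
    intro j; split_ifs <;> ring
  rw [Finset.sum_congr rfl fun j _ => h1 j, Finset.sum_sub_distrib, Finset.sum_add_distrib]
  simp
  ring

theorem derivedMap_act {n : ℕ}
    (hd : ∀ (i : ℤ) (x : V.carrier), x ∈ V.deg i → d x ∈ V.deg (i + q))
    (hq : Odd q) (σ : Equiv.Perm (Fin n)) (i : Fin n)
    (f : MultiMap V n) :
    derivedMap V d i (endAct V σ f) = endAct V.shift σ (derivedMap V d (σ i) f) := by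
  refine multiMap_ext fun p x hx => ?_
  rw [derivedMap_apply V d i _ p x fun j _ => hx j, endAct_apply V σ f _ _ (marked_mem hd i hx),
    endAct_apply V.shift σ _ p x hx,
    derivedMap_apply V d (σ i) f (fun j => p (σ⁻¹ j)) _ fun j _ => hx _, map_smul, smul_smul,
    smul_smul, ← parSign_add, ← parSign_add]
  congr 2
  · have h1 : (1 : ZMod 2) + 1 = 0 := by decide
    have hq' : (q : ZMod 2) = 1 := by
      rcases zmod_two_cases (q : ZMod 2) with h | h
      · rw [ZMod.intCast_eq_zero_iff_even] at h
        exact absurd hq (Int.not_odd_iff_even.2 h)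
      · exact h
    refine koszulExp_shift σ i (fun j => (p j : ZMod 2)) _ (fun j hj => ?_) ?_
    · rw [if_neg hj]
      push_cast
      rw [hq', sub_add_cancel]
    · rw [if_pos rfl]
      push_cast
      rw [sub_eq_add_neg, neg_eq_of_add_eq_zero_left h1]
  · refine congrArg V.s (congrArg f (funext fun j => ?_))
    obtain ⟨j, rfl⟩ := σ.surjective j
    simp only [marked, perm_inv_apply, σ.injective.eq_iff]

theorem marked_inner_self {m n k : ℕ} (h : k + 1 = m + n) (i : Fin m) (b : Fin n)
    (x : Fin k → V.shift.carrier) :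
    (fun b' => marked d (innerPos h i b) x (innerPos h i b')) =
      marked d b fun b' => x (innerPos h i b') := by
  funext b'
  simp only [marked, innerPos_inj]

/-- Composition at the marked input of the outer operation. -/
theorem derivedMap_comp_inner {m n k : ℕ} (h : k + 1 = m + n) (i : Fin m) (b : Fin n)
    (f : MultiMap V m) (g : MultiMap V n) :
    derivedMap V d (innerPos h i b) (endComp V h i f g) =
      endComp V.shift h i (derivedMap V d i f) (derivedMap V d b g) := by
  refine multiMap_ext fun p x hx => ?_
  have hplug : ∀ a : Fin m, a < i → ∀ y, plug h i x y a ∈ V.shift.deg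
      (if ha : a = i then 0 else p (outerPos h i a ha)) := by
    intro a ha y
    rw [plug_ne V.shift h i x y ha.ne, dif_neg ha.ne]
    exact hx _
  rw [derivedMap_apply V d _ _ p x fun j _ => hx j, endComp_apply, endComp_apply,
    derivedMap_apply V d i f _ _ fun a ha => hplug a ha _,
    sumBefore_inner h i b _ (fun a => ((if ha : a = i then 0 else p (outerPos h i a ha) : ℤ) :
      ZMod 2)) (fun a ha => by rw [dif_neg ha]),
    parSign_add, mul_smul, marked_inner_self, ← map_smul V.s (parSign K (sumBefore b _))]
  congr 2
  rw [← update_plug V h i _ 0, ← MultilinearMap.map_update_smul, update_plug]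
  refine congrArg f (funext fun a => ?_)
  by_cases ha : a = i
  · subst ha
    rw [plug_self, marked, if_pos rfl, plug_self,
      derivedMap_apply V d b g _ _ fun j _ => hx (innerPos h a j), map_smul,
      LinearEquiv.symm_apply_apply]
  · rw [plug_ne V h i _ _ ha, marked, marked, if_neg ha, if_neg (outerPos_ne_innerPos h i ha b),
      plug_ne V.shift h i _ _ ha]

/-- Composition at an unmarked input of the outer operation, where the Leibniz rule for the inner
operation and `d² = 0` enter. The marked input `b` of the inner operation becomes irrelevant. -/
theorem derivedMap_comp_outer {m n k : ℕ}
    (hd : ∀ (i : ℤ) (x : V.carrier), x ∈ V.deg i → d x ∈ V.deg (i + q))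
    (hq : Odd q) (h : k + 1 = m + n) (i a : Fin m)
    (ha : a ≠ i) (b : Fin n) {e : ℤ} (he : Even e)
    (hdd : ∀ x, d (d x) = 0) (f : MultiMap V m) {g : MultiMap V n}
    (hg : g ∈ homogeneousMaps V n ((n - 1) * e))
    (hL : ∀ (p : Fin n → ℤ) (x : Fin n → V.carrier), (∀ i, x i ∈ V.deg (p i)) →
      d (g x) = ∑ i, (-1 : K) ^ (∑ j with j < i, p j) • g (Function.update x i (d (x i)))) :
    derivedMap V d (outerPos h i a ha) (endComp V h i f g) =
      endComp V.shift h i (derivedMap V d a f) (derivedMap V d b g) := by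
  refine multiMap_ext fun p x hx => ?_
  have hy := derivedMap_mem hd b hg _ _ fun b => hx (innerPos h i b)
  rw [derivedMap_apply V d _ _ p x fun j _ => hx j, endComp_apply, endComp_apply,
    derivedMap_apply V d a f _ _ fun a' _ => plug_mem V.shift h i hx hy a']
  congr 2
  · refine sumBefore_outer h i a ha _ _ (fun a' ha' => by rw [dif_neg ha']) ?_
    rw [dif_pos rfl]
    have h2 : (((n - 1) * (e + q - 1) : ℤ) : ZMod 2) = 0 := by
      rw [ZMod.intCast_eq_zero_iff_even]
      exact (even_derived he hq).mul_left _
    rw [Int.cast_add, h2, add_zero, Int.cast_sum]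
  refine congrArg f (funext fun a' => ?_)
  by_cases ha' : a' = i
  · subst ha'
    rw [plug_self, marked, if_neg ha.symm, plug_self,
      derivedMap_apply V d b g _ _ fun j _ => hx (innerPos h a' j), map_smul,
      LinearEquiv.symm_apply_apply, map_smul, hL _ _ (marked_mem hd b fun b => hx _),
      Finset.sum_eq_single b]
    · have h1 : (-1 : K) ^ (∑ j with j < b, if j = b then p (innerPos h a' j) - 1
          else p (innerPos h a' j) - 1 + q) =
          parSign K (sumBefore b fun j => (p (innerPos h a' j) : ZMod 2)) := by
        rw [← parSign_intCast, Int.cast_sum, Finset.sum_filter, sumBefore]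
        refine congrArg _ (Finset.sum_congr rfl fun j _ => ?_)
        split_ifs with hj hjb
        · exact absurd hjb hj.ne
        · have h2 : ((q - 1 : ℤ) : ZMod 2) = 0 := by
            rw [ZMod.intCast_eq_zero_iff_even]
            exact hq.sub_odd odd_one
          rw [sub_add_eq_add_sub, add_sub_assoc, Int.cast_add, h2, add_zero]
        · rfl
      have h2 : ∀ c : ZMod 2, c + c = 0 := by decide
      -- the sign of the Leibniz rule cancels the sign of the inner derived operation
      rw [h1, smul_smul, ← parSign_add, h2, parSign, if_pos rfl, one_smul]
      refine congrArg g (funext fun b' => ?_)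
      rw [marked, if_neg (outerPos_ne_innerPos h a' ha b').symm]
      by_cases hb : b' = b
      · subst hb
        rw [Function.update_self, marked, if_pos rfl]
      · rw [Function.update_of_ne hb, marked, if_neg hb]
    -- differentiating an unmarked input a second time gives zero
    · intro c _ hc
      rw [MultilinearMap.map_coord_zero _ c, smul_zero]
      rw [Function.update_self, marked, if_neg hc, hdd]
    · intro hb
      exact absurd (Finset.mem_univ b) hb
  · rw [plug_ne V h i _ _ ha', marked, marked, plug_ne V.shift h i _ _ ha']
    simp only [outerPos_inj]

end Derived

/-! ### The action of the white product on the shifted space -/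

section DGAlgebras

variable {K : Type u} [Field K] {P : QuadraticData.{u, v} K} {e q : ℤ} {he : Even e}
  (A : DGAlgebra.{u, v, w} P e q he)

/-- The derived operation of an operation of `P`, as an element of the endomorphism operad. -/
def derivedOp {n : ℕ} (i : Fin n) :
    P.operad.obj n →ₗ[K] homogeneousMaps A.V.shift n ((n - 1) * (e + q - 1)) :=
  (derivedMap A.V A.d i ∘ₗ A.rep.multi n).codRestrict _ fun f =>
    derivedMap_mem A.d_mem i (A.rep.multi_mem f)

theorem derivedOp_act (hq : Odd q) {n : ℕ} (σ : Equiv.Perm (Fin n)) (i : Fin n)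
    (f : P.operad.obj n) :
    derivedOp A i (P.operad.act σ f) =
      (endOperad A.V.shift (e + q - 1) (even_derived he hq)).act σ (derivedOp A (σ i) f) :=
  Subtype.ext ((congrArg (derivedMap A.V A.d i) (A.rep.multi_act σ f)).trans
    (derivedMap_act A.d_mem hq σ i _))

theorem derivedOp_comp_inner (hq : Odd q) {m n k : ℕ} (h : k + 1 = m + n) (i : Fin m) (b : Fin n)
    (f : P.operad.obj m) (g : P.operad.obj n) :
    derivedOp A (innerPos h i b) (P.operad.comp h i f g) =
      (endOperad A.V.shift (e + q - 1) (even_derived he hq)).comp h i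
        (derivedOp A i f) (derivedOp A b g) :=
  Subtype.ext ((congrArg (derivedMap A.V A.d _) (A.rep.multi_comp h i f g)).trans
    (derivedMap_comp_inner h i b _ _))

theorem derivedOp_comp_outer (hq : Odd q) {m n k : ℕ} (h : k + 1 = m + n) (i a : Fin m)
    (ha : a ≠ i) (b : Fin n) (f : P.operad.obj m) (g : P.operad.obj n) :
    derivedOp A (outerPos h i a ha) (P.operad.comp h i f g) =
      (endOperad A.V.shift (e + q - 1) (even_derived he hq)).comp h i
        (derivedOp A a f) (derivedOp A b g) :=
  Subtype.ext ((congrArg (derivedMap A.V A.d _) (A.rep.multi_comp h i f g)).trans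
    (derivedMap_comp_outer A.d_mem hq h i a ha b he A.d_d _ (A.rep.multi_mem g) (A.d_op g)))

/-- The bilinear extension of `(e_i, f) ↦ derivedOp A i f`. -/
def derivedPairing (n : ℕ) : (Fin n → K) →ₗ[K] P.operad.obj n →ₗ[K]
    homogeneousMaps A.V.shift n ((n - 1) * (e + q - 1)) :=
  ∑ i, (LinearMap.proj i : (Fin n → K) →ₗ[K] K).smulRight (derivedOp A i)

theorem derivedPairing_apply {n : ℕ} (v : Fin n → K) (f : P.operad.obj n) :
    derivedPairing A n v f = ∑ i, v i • derivedOp A i f := by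
  simp [derivedPairing, LinearMap.sum_apply]

theorem derivedPairing_act (hq : Odd q) {n : ℕ} (σ : Equiv.Perm (Fin n)) (v : Fin n → K)
    (f : P.operad.obj n) :
    derivedPairing A n (fun i => v (σ i)) (P.operad.act σ f) =
      (endOperad A.V.shift (e + q - 1) (even_derived he hq)).act σ (derivedPairing A n v f) := by
  rw [derivedPairing_apply, derivedPairing_apply, ← Equiv.sum_comp σ (fun i => v i • _)]
  refine Eq.trans (Finset.sum_congr rfl fun i _ => ?_)
    (map_sum ((endOperad A.V.shift (e + q - 1) (even_derived he hq)).act σ) _ _).symm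
  rw [derivedOp_act A hq]
  exact (map_smul ((endOperad A.V.shift (e + q - 1) (even_derived he hq)).act σ) _ _).symm

theorem derivedPairing_comp (hq : Odd q) {m n k : ℕ} (h : k + 1 = m + n) (i : Fin m)
    (v : Fin m → K) (w : Fin n → K) (f : P.operad.obj m) (g : P.operad.obj n) :
    derivedPairing A k (permComp h i v w) (P.operad.comp h i f g) =
      (endOperad A.V.shift (e + q - 1) (even_derived he hq)).comp h i
        (derivedPairing A m v f) (derivedPairing A n w g) := by
  have hR : (endOperad A.V.shift (e + q - 1) (even_derived he hq)).comp h i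
        (derivedPairing A m v f) (derivedPairing A n w g) =
      ∑ a, ∑ b, (v a * w b) • (endOperad A.V.shift (e + q - 1) (even_derived he hq)).comp h i
        (derivedOp A a f) (derivedOp A b g) := by
    rw [derivedPairing_apply, derivedPairing_apply]
    refine (LinearMap.map_sum₂ _ _ _ _).trans (Finset.sum_congr rfl fun a _ => ?_)
    refine (map_sum _ _ _).trans (Finset.sum_congr rfl fun b _ => ?_)
    refine (LinearMap.map_smul₂ _ _ _ _).trans ?_
    rw [mul_smul]
    exact congrArg _ (map_smul _ _ _)
  rw [hR, derivedPairing_apply, sum_pos h i, sum_ne i]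
  refine congrArg₂ _ (Finset.sum_congr rfl fun a _ => ?_) (Finset.sum_congr rfl fun b _ => ?_)
  · rw [permComp_outer, Finset.mul_sum, Finset.sum_smul]
    exact Finset.sum_congr rfl fun b _ => by rw [derivedOp_comp_outer A hq h i a.1 a.2 b]; rfl
  · rw [permComp_inner, derivedOp_comp_inner A hq]; rfl

/-- The morphism of operads `Perm ⊗ P → End(sA)` given by the derived operations. -/
def derivedHom (hq : Odd q) : Hom (tensorOperad (permOperad K) P.operad).toPreOperad
    (endOperad A.V.shift (e + q - 1) (even_derived he hq)).toPreOperad :=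
  Hom.ofPairing (derivedPairing A)
    (by
      refine (derivedPairing_apply A (fun _ => (1 : K)) P.operad.one).trans ?_
      rw [Fin.sum_univ_one, one_smul]
      exact Subtype.ext (MultilinearMap.ext fun x => congrArg A.V.s (A.rep.multi_one _)))
    (fun σ v f => derivedPairing_act A hq σ v f)
    (fun h i v w f g => derivedPairing_comp A hq h i v w f g)

/-- The composite `F(E_Perm ⊗ E) → F(E_Perm) ⊗ F(E) → Perm ⊗ P → End(sA)`. -/
def whiteHom (hq : Odd q) : Hom (freeOperad (whiteProduct (permData K) P).ρ).toPreOperad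
    (endOperad A.V.shift (e + q - 1) (even_derived he hq)).toPreOperad :=
  (whitePhi (permData K) P).trans
    ((Hom.tensor (Q' := P.operad) (permProj K)
      ((freeOperad P.ρ).proj (ArityThree P.R))).trans (derivedHom A hq))

/-- The structure of a `Perm ∘ P`-algebra on `sA`. -/
def derivedRep (hq : Odd q) :
    AlgebraOn (whiteProduct (permData K) P) A.V.shift (e + q - 1) (even_derived he hq) :=
  PreOperad.quotientLift (whiteHom A hq) (by
    rintro _ _ ⟨x, hx⟩
    exact (congrArg ((derivedHom A hq).app 3)
      (Hom.tensor_whiteRel (P := permData K) (Q' := P.operad) (permProj K)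
        ((freeOperad P.ρ).proj (ArityThree P.R)) (fun _ => permProj_relation)
        (fun _ hy => (Submodule.Quotient.mk_eq_zero _).2 (.of _ (.mk _ hy))) hx)).trans
      (map_zero _))

theorem derivedRep_gen (hq : Odd q) (j : Fin 2) (μ : P.E) :
    (derivedRep A hq).app 2 ((whiteProduct (permData K) P).gen (permGen K j ⊗ₜ[K] μ)) =
      derivedOp A j (P.gen μ) := by
  have h : (whitePhi (permData K) P).app 2
      (freeGen (whiteProduct (permData K) P).ρ (permGen K j ⊗ₜ[K] μ)) =
      freeGen (permRep K) (permGen K j) ⊗ₜ[K] freeGen P.ρ μ :=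
    (freeLift_gen _ _ _ _ _).trans (TensorProduct.map_tmul _ _ _ _)
  change (derivedHom A hq).app 2 ((Hom.tensor (Q' := P.operad) (permProj K)
      ((freeOperad P.ρ).proj (ArityThree P.R))).app 2 ((whitePhi (permData K) P).app 2
        (freeGen (whiteProduct (permData K) P).ρ (permGen K j ⊗ₜ[K] μ)))) = _
  rw [h]
  change derivedPairing A 2 ((permProj K).app 2 (freeGen (permRep K) (permGen K j))) (P.gen μ) = _
  rw [permProj_gen, derivedPairing_apply, Finset.sum_eq_single j]
  · rw [permGen, Pi.single_eq_same, one_smul]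
  · intro i _ hi
    rw [permGen, Pi.single_eq_of_ne hi, zero_smul]
  · exact fun hj => absurd (Finset.mem_univ j) hj

theorem derivedRep_bracket (hq : Odd q) (j : Fin 2) (μ : P.E) (x y : A.V.shift.carrier) :
    (derivedRep A hq).bracket (permGen K j ⊗ₜ[K] μ) x y =
      derivedMap A.V A.d j (A.rep.multi 2 (P.gen μ)) ![x, y] :=
  congrArg (fun f : homogeneousMaps A.V.shift 2 (((2 : ℕ) - 1) * (e + q - 1)) => f.1 ![x, y])
    (derivedRep_gen A hq j μ)

end DGAlgebras

end DerivedBrackets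

end

open DerivedBrackets in
theorem theorem1 {K : Type*} [Field K] [CharZero K] (P : QuadraticData K)
    (e q : ℤ) (he : Even e) (hq : Odd q) (A : DGAlgebra P e q he) :
    ∃ φ : AlgebraOn (whiteProduct (permData K) P) A.V.shift (e + q - 1) (even_derived he hq),
      ∀ (μ : P.E) (i : ℤ) (x y : A.V.carrier), x ∈ A.V.deg i →
        φ.bracket (permGen K 1 ⊗ₜ[K] μ) (A.V.s x) (A.V.s y) =
            -((-1 : K) ^ i • A.V.s (A.rep.bracket μ (A.d x) y)) ∧
          φ.bracket (permGen K 0 ⊗ₜ[K] μ) (A.V.s x) (A.V.s y) =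
            A.V.s (A.rep.bracket μ x (A.d y)) := by
  refine ⟨derivedRep A hq, fun μ i x y hx => ⟨?_, ?_⟩⟩
  · have hx' : A.V.s x ∈ A.V.shift.deg (i + 1) := by
      change x ∈ A.V.deg (i + 1 - 1)
      rwa [add_sub_cancel_right]
    have hm : marked A.d 1 ![A.V.s x, A.V.s y] = ![A.d x, y] := by
      funext j
      fin_cases j <;> rfl
    rw [derivedRep_bracket, derivedMap_apply A.V A.d 1 _ ![i + 1, 0], hm]
    · have hs : parSign K (sumBefore 1 fun j => ((![i + 1, 0] j : ℤ) : ZMod 2)) =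
          -(-1 : K) ^ i := by
        simp only [sumBefore, Fin.sum_univ_two]
        rw [if_pos Fin.zero_lt_one, if_neg (lt_irrefl _), add_zero]
        refine (parSign_intCast (i + 1)).trans ?_
        rw [zpow_add_one₀ (neg_ne_zero.2 one_ne_zero), mul_neg_one]
      rw [hs, neg_smul]
      rfl
    · intro j hj
      obtain rfl : j = 0 := (Fin.lt_one_iff j).1 hj
      exact hx'
  · have hm : marked A.d 0 ![A.V.s x, A.V.s y] = ![x, A.d y] := by
      funext j
      fin_cases j <;> rfl
    rw [derivedRep_bracket, derivedMap_apply A.V A.d 0 _ ![0, 0], hm]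
    · have hs : parSign K (sumBefore (0 : Fin 2) fun j => ((![0, 0] j : ℤ) : ZMod 2)) = 1 := by
        simp [sumBefore, parSign]
      rw [hs, one_smul]
      rfl
    · exact fun j hj => absurd hj (Fin.not_lt_zero j)
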